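/- Let $n \ge 3$ be an integer and let $p > 1$ be a real number. Let $\mathcal K^n_o$ denote the set of all convex bodies (nonempty compact convex sets) in $\mathbb R^n$ that contain the origin, and let $\mathcal P^n_o \subseteq \mathcal K^n_o$ denote the set of all convex polytopes (convex hulls of finite sets of points) in $\mathbb R^n$ that contain the origin. For $K \in \mathcal K^n_o$ write $h(K,u) = \max_{x\in K}\langle x,u\rangle$ for its support function. For $K, L \in \mathcal K^n_o$ the $L_p$-Minkowski sum $K +_p L \in \mathcal K^n_o$ is defined by $h(K +_p L,\cdot)^p = h(K,\cdot)^p + h(L,\cdot)^p$, and for $c \ge 0$ let $cK = \{cx : x \in K\}$. For $P \in \mathcal P^n_o$ and a unit vector $v$ put $F(P,v) = \{x \in P : \langle x,v\rangle = h(P,v)\}$, and let $\mathcal N(P)$ be the (finite) set of outer unit normals of facets of $P$, i.e. of those unit vectors $v$ for which $F(P,v)$ has dimension $n-1$. The asymmetric $L_p$-projection bodies $\Pi_p^+P, \Pi_p^-P \in \mathcal K^n_o$ are defined by $$h(\Pi_p^{\pm}P,u)^p = \sum_{v \in \mathcal N(P),\; 0\notin F(P,v)} \mathrm{vol}_{n-1}(F(P,v))\,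 h(P,v)^{1-p}\, \langle v,u\rangle_{\pm}^p \qquad (u \in \mathbb R^n),$$ where $t_+ = \max\{t,0\}$ and $t_- = \max\{-t,0\}$. A map $\Phi : \mathcal P^n_o \to \mathcal K^n_o$ is called an $L_p$-Minkowski valuation if $$\Phi(P\cup Q) +_p \Phi(P\cap Q) = \Phi(P) +_p \Phi(Q)$$ for all $P,Q \in \mathcal P^n_o$ with $P\cup Q,\, P\cap Q \in \mathcal P^n_o$, and it is called $\mathrm{SL}(n)$-contravariant if $\Phi(\phi P) = \phi^{-t}\,\Phi(P)$ for all $P \in \mathcal P^n_o$ and all $\phi \in \mathrm{SL}(n)$. Theorem. A map $\Phi : \mathcal P^n_o \to \mathcal K^n_o$ is an $\mathrm{SL}(n)$-contravariant $L_p$-Minkowski valuation if and only if there exist constants $c_1, c_2 \ge 0$ such that $$\Phi P = c_1\, \Pi_p^+P +_p c_2\, \Pi_p^-P \qquad \text{for all } P \in \mathcal P^n_o .$$ -/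

import Mathlib

open MeasureTheory

noncomputable section

namespace LpMinkowski

/-! ### Convex bodies and polytopes containing the origin -/

/-- Euclidean space `ℝⁿ`. -/
abbrev E (n : ℕ) : Type := EuclideanSpace ℝ (Fin n)

/-- A convex polytope: the convex hull of a finite set of points. -/
def IsPolytope {n : ℕ} (P : Set (E n)) : Prop :=
  ∃ S : Finset (E n), P = convexHull ℝ (S : Set (E n))

/-- The convex bodies of `ℝⁿ` containing the origin. -/
abbrev BodyO (n : ℕ) : Type := {K : ConvexBody (E n) // (0 : E n) ∈ K}

/-- The convex polytopes of `ℝⁿ` containing the origin. -/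
abbrev PolytopeO (n : ℕ) : Type :=
  {P : ConvexBody (E n) // IsPolytope (P : Set (E n)) ∧ (0 : E n) ∈ P}

/-- The image of a convex body under a linear map. -/
def mapBody {n : ℕ} (f : E n →ₗ[ℝ] E n) (K : ConvexBody (E n)) : ConvexBody (E n) where
  carrier := f '' (K : Set (E n))
  convex' := K.convex.linear_image f
  isCompact' := K.isCompact.image f.continuous_of_finiteDimensional
  nonempty' := K.nonempty.image f

/-- The image of a convex body containing the origin under a linear map. -/
def BodyO.map {n : ℕ} (f : E n →ₗ[ℝ] E n) (K : BodyO n) : BodyO n :=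
  ⟨mapBody f K.1, ⟨0, K.2, map_zero f⟩⟩

/-- The image of a polytope containing the origin under a linear map. -/
def PolytopeO.map {n : ℕ} (f : E n →ₗ[ℝ] E n) (P : PolytopeO n) : PolytopeO n :=
  ⟨mapBody f P.1, by
    classical
    obtain ⟨S, hS⟩ := P.2.1
    refine ⟨S.image f, ?_⟩
    change f '' (P.1 : Set (E n)) = _
    rw [hS, Finset.coe_image, f.image_convexHull], ⟨0, P.2.2, map_zero f⟩⟩

/-- The scalar multiple `c K = {c x : x ∈ K}`. -/
def BodyO.scale {n : ℕ} (c : ℝ) (K : BodyO n) : BodyO n :=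
  ⟨c • K.1, ⟨0, K.2, smul_zero c⟩⟩

/-! ### Support functions -/

/-- The support function `h(K, u) = max_{x ∈ K} ⟨x, u⟩`. -/
def supp {n : ℕ} (K : ConvexBody (E n)) (u : E n) : ℝ :=
  sSup ((fun x : E n => inner ℝ x u) '' (K : Set (E n)))

theorem isGreatest_supp {n : ℕ} (K : ConvexBody (E n)) (u : E n) :
    IsGreatest ((fun x : E n => inner ℝ x u) '' (K : Set (E n))) (supp K u) := by
  have hc : IsCompact ((fun x : E n => inner ℝ x u) '' (K : Set (E n))) :=
    K.isCompact.image (by fun_prop)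
  exact hc.isGreatest_sSup (K.nonempty.image _)

theorem inner_le_supp {n : ℕ} (K : ConvexBody (E n)) (u : E n) {x : E n} (hx : x ∈ K) :
    inner ℝ x u ≤ supp K u :=
  (isGreatest_supp K u).2 ⟨x, hx, rfl⟩

theorem exists_inner_eq_supp {n : ℕ} (K : ConvexBody (E n)) (u : E n) :
    ∃ x ∈ K, inner ℝ x u = supp K u :=
  (isGreatest_supp K u).1

theorem supp_nonneg {n : ℕ} (K : BodyO n) (u : E n) : 0 ≤ supp K.1 u := by
  simpa using inner_le_supp K.1 u K.2

/-- Nonnegative sublinear functions. -/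
structure IsSublinear {n : ℕ} (f : E n → ℝ) : Prop where
  nonneg : ∀ u, 0 ≤ f u
  add_le : ∀ u v, f (u + v) ≤ f u + f v
  smul_eq : ∀ s : ℝ, 0 < s → ∀ u, f (s • u) = s * f u

theorem isSublinear_supp {n : ℕ} (K : BodyO n) : IsSublinear (supp K.1) where
  nonneg := supp_nonneg K
  add_le u v := by
    obtain ⟨x, hx, h⟩ := exists_inner_eq_supp K.1 (u + v)
    rw [← h, inner_add_right]
    exact add_le_add (inner_le_supp _ _ hx) (inner_le_supp _ _ hx)
  smul_eq s hs u := by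
    apply le_antisymm
    · obtain ⟨x, hx, h⟩ := exists_inner_eq_supp K.1 (s • u)
      rw [← h, real_inner_smul_right]
      exact mul_le_mul_of_nonneg_left (inner_le_supp _ _ hx) hs.le
    · obtain ⟨x, hx, h⟩ := exists_inner_eq_supp K.1 u
      rw [← h, ← real_inner_smul_right]
      exact inner_le_supp _ _ hx

/-- The convex body `{x : ⟨x, u⟩ ≤ f u for all u}`. If the nonnegative function `f` is sublinear,
this is the unique convex body with support function `f` (see `supp_ofSupport`). -/
def ofSupport {n : ℕ} (f : E n → ℝ) (hf : ∀ u, 0 ≤ f u) : BodyO n :=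
  ⟨{ carrier := {x : E n | ∀ u, inner ℝ x u ≤ f u}
     convex' := by
      intro x hx y hy a b ha hb hab u
      rw [inner_add_left, real_inner_smul_left, real_inner_smul_left]
      calc a * inner ℝ x u + b * inner ℝ y u ≤ a * f u + b * f u :=
            add_le_add (mul_le_mul_of_nonneg_left (hx u) ha) (mul_le_mul_of_nonneg_left (hy u) hb)
        _ = f u := by rw [← add_mul, hab, one_mul]
     isCompact' := by
      apply Metric.isCompact_of_isClosed_isBounded
      · rw [Set.ofPred_forall]
        exact isClosed_iInter fun u => isClosed_le (by fun_prop) continuous_const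
      · rw [isBounded_iff_forall_norm_le]
        refine ⟨∑ i : Fin n, (f (EuclideanSpace.single i 1) + f (-EuclideanSpace.single i 1)), ?_⟩
        intro x hx
        have hsum : x = ∑ i : Fin n, x i • (EuclideanSpace.single i (1 : ℝ) : E n) := by
          ext j
          simp [Finset.sum_apply, Pi.single_apply]
        calc ‖x‖ = ‖∑ i : Fin n, x i • (EuclideanSpace.single i (1 : ℝ) : E n)‖ := by rw [← hsum]
          _ ≤ ∑ i : Fin n, ‖x i • (EuclideanSpace.single i (1 : ℝ) : E n)‖ := norm_sum_le _ _
          _ ≤ _ := by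
            refine Finset.sum_le_sum fun i _ => ?_
            have h1 := hx (EuclideanSpace.single i 1)
            have h2 := hx (-EuclideanSpace.single i 1)
            have h3 := hf (EuclideanSpace.single i 1)
            have h4 := hf (-EuclideanSpace.single i 1)
            simp only [inner_neg_right, EuclideanSpace.inner_single_right] at h1 h2
            simp at h1 h2
            simp only [norm_smul, PiLp.norm_single, norm_one, mul_one, Real.norm_eq_abs]
            rw [abs_le]
            constructor <;> linarith
     nonempty' := ⟨0, fun u => by simpa using hf u⟩ },
   fun u => by simpa using hf u⟩

theorem supp_ofSupport {n : ℕ} {f : E n → ℝ} (hf : IsSublinear f) (u : E n) :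
    supp (ofSupport f hf.nonneg).1 u = f u := by
  have f0 : f 0 = 0 := by
    have := hf.smul_eq 2 (by norm_num) 0
    rw [smul_zero] at this
    linarith
  apply le_antisymm
  · obtain ⟨x, hx, h⟩ := exists_inner_eq_supp (ofSupport f hf.nonneg).1 u
    rw [← h]
    exact hx u
  · suffices h : ∃ g : E n →ₗ[ℝ] ℝ, g u = f u ∧ ∀ x, g x ≤ f x by
      obtain ⟨g, hgu, hg⟩ := h
      let x : E n := (InnerProductSpace.toDual ℝ (E n)).symm (LinearMap.toContinuousLinearMap g)
      have hx : ∀ v, inner ℝ x v = g v := fun v => by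
        simp [x, InnerProductSpace.toDual_symm_apply]
      rw [← hgu, ← hx u]
      refine inner_le_supp _ _ ?_
      intro v
      rw [hx]
      exact hg v
    by_cases hu : u = 0
    · exact ⟨0, by simp [hu, f0], fun x => by simpa using hf.nonneg x⟩
    · obtain ⟨g, hg1, hg2⟩ := exists_extension_of_le_sublinear
        (LinearPMap.mkSpanSingleton u (f u) hu) f hf.smul_eq hf.add_le (by
          rintro ⟨x, hx⟩
          obtain ⟨t, rfl⟩ := Submodule.mem_span_singleton.1 hx
          have hval : LinearPMap.mkSpanSingleton (σ := RingHom.id ℝ) u (f u) hu ⟨t • u, hx⟩ = t * f u :=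
            LinearPMap.mkSpanSingleton'_apply u (f u) _ t hx
          rw [hval]
          rcases lt_trichotomy t 0 with ht | ht | ht
          · have h1 := hf.smul_eq (-t) (by linarith) u
            have h2 := hf.add_le (t • u) ((-t) • u)
            rw [← add_smul, add_neg_cancel, zero_smul, f0] at h2
            change t * f u ≤ f (t • u)
            linarith
          · subst ht
            simp [f0]
          · exact (hf.smul_eq t ht u).ge)
      refine ⟨g, ?_, hg2⟩
      have := hg1 ⟨u, Submodule.mem_span_singleton_self u⟩
      rw [this]
      exact LinearPMap.mkSpanSingleton'_apply_self u (f u) _ _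

theorem isSublinear_lp {n : ℕ} {ι : Type*} (s : Finset ι) {p : ℝ} (hp : 1 ≤ p) (w : ι → ℝ)
    (hw : ∀ i ∈ s, 0 ≤ w i) (g : ι → E n → ℝ) (hg : ∀ i ∈ s, IsSublinear (g i)) :
    IsSublinear (fun u => (∑ i ∈ s, w i * g i u ^ p) ^ (1 / p)) := by
  have hp0 : p ≠ 0 := by linarith
  have key : ∀ i ∈ s, ∀ u, w i * g i u ^ p = (w i ^ (1 / p) * g i u) ^ p := by
    intro i hi u
    rw [Real.mul_rpow (Real.rpow_nonneg (hw i hi) _) ((hg i hi).nonneg u),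
      ← Real.rpow_mul (hw i hi), one_div_mul_cancel hp0, Real.rpow_one]
  have hnn : ∀ i ∈ s, ∀ u, 0 ≤ w i ^ (1 / p) * g i u := fun i hi u =>
    mul_nonneg (Real.rpow_nonneg (hw i hi) _) ((hg i hi).nonneg u)
  have hsum : ∀ u, ∑ i ∈ s, w i * g i u ^ p = ∑ i ∈ s, (w i ^ (1 / p) * g i u) ^ p := fun u =>
    Finset.sum_congr rfl fun i hi => key i hi u
  have hsnn : ∀ u, 0 ≤ ∑ i ∈ s, w i * g i u ^ p := fun u =>
    Finset.sum_nonneg fun i hi => mul_nonneg (hw i hi) (Real.rpow_nonneg ((hg i hi).nonneg u) _)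
  refine ⟨fun u => Real.rpow_nonneg (hsnn u) _, fun u v => ?_, fun t ht u => ?_⟩
  · refine le_trans ?_ (le_trans (Real.Lp_add_le_of_nonneg s hp (fun i hi => hnn i hi u)
      (fun i hi => hnn i hi v)) (by rw [← hsum, ← hsum]))
    refine Real.rpow_le_rpow (hsnn _) ?_ (by positivity)
    rw [hsum]
    refine Finset.sum_le_sum fun i hi => ?_
    refine Real.rpow_le_rpow (hnn i hi _) ?_ (by linarith)
    rw [← mul_add]
    exact mul_le_mul_of_nonneg_left ((hg i hi).add_le u v) (Real.rpow_nonneg (hw i hi) _)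
  · have : ∑ i ∈ s, w i * g i (t • u) ^ p = t ^ p * ∑ i ∈ s, w i * g i u ^ p := by
      rw [Finset.mul_sum]
      refine Finset.sum_congr rfl fun i hi => ?_
      rw [(hg i hi).smul_eq t ht u, Real.mul_rpow ht.le ((hg i hi).nonneg u)]
      ring
    simp only [this]
    rw [Real.mul_rpow (by positivity) (hsnn u), ← Real.rpow_mul ht.le, mul_one_div_cancel hp0,
      Real.rpow_one]

/-! ### `L_p`-Minkowski addition -/

/-- The `L_p`-Minkowski sum `K +_p L`, with `h(K +_p L, ·)^p = h(K, ·)^p + h(L, ·)^p`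
(see `supp_lpSum`). -/
def lpSum {n : ℕ} (p : ℝ) (K L : BodyO n) : BodyO n :=
  ofSupport (fun u => (supp K.1 u ^ p + supp L.1 u ^ p) ^ (1 / p)) fun u =>
    Real.rpow_nonneg (add_nonneg (Real.rpow_nonneg (supp_nonneg K u) _)
      (Real.rpow_nonneg (supp_nonneg L u) _)) _

theorem supp_lpSum {n : ℕ} {p : ℝ} (hp : 1 < p) (K L : BodyO n) (u : E n) :
    supp (lpSum p K L).1 u ^ p = supp K.1 u ^ p + supp L.1 u ^ p := by
  have h : IsSublinear (fun u => (supp K.1 u ^ p + supp L.1 u ^ p) ^ (1 / p)) := by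
    have := isSublinear_lp (Finset.univ : Finset (Fin 2)) hp.le (fun _ => 1) (by simp)
      ![supp K.1, supp L.1] (by
        intro i _
        fin_cases i
        · exact isSublinear_supp K
        · exact isSublinear_supp L)
    simpa using this
  have h1 := supp_ofSupport h u
  unfold lpSum
  rw [h1, ← Real.rpow_mul (add_nonneg (Real.rpow_nonneg (supp_nonneg K u) _)
      (Real.rpow_nonneg (supp_nonneg L u) _)), one_div_mul_cancel (by linarith), Real.rpow_one]

/-! ### Facets and the asymmetric `L_p`-projection bodies -/

/-- `F(P, v) = P ∩ {x : ⟨x, v⟩ = h(P, v)}`. -/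
def face {n : ℕ} (P : ConvexBody (E n)) (v : E n) : Set (E n) :=
  (P : Set (E n)) ∩ {x | inner ℝ x v = supp P v}

/-- The set of all outer unit normals of facets of `P`: the unit vectors `v` for which `F(P, v)` has
dimension `n - 1`. -/
def facetNormals {n : ℕ} (P : ConvexBody (E n)) : Set (E n) :=
  {v | ‖v‖ = 1 ∧ Module.finrank ℝ (vectorSpan ℝ (face P v)) + 1 = n}

theorem face_eq_convexHull {n : ℕ} {P : ConvexBody (E n)} {S : Finset (E n)}
    (hS : (P : Set (E n)) = convexHull ℝ (S : Set (E n))) (v : E n) :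
    face P v = convexHull ℝ {x | x ∈ S ∧ inner ℝ x v = supp P v} := by
  have hSP : ∀ x ∈ S, x ∈ P := fun x hx => by
    have : x ∈ (P : Set (E n)) := hS ▸ subset_convexHull ℝ _ hx
    exact this
  apply Set.Subset.antisymm
  · rintro x ⟨hxP, hx⟩
    rw [hS, Finset.mem_convexHull'] at hxP
    obtain ⟨w, hw0, hw1, rfl⟩ := hxP
    have hx' : ∑ y ∈ S, w y * (supp P v - inner ℝ y v) = 0 := by
      have hx2 : inner ℝ (∑ y ∈ S, w y • y) v = supp P v := hx
      rw [sum_inner] at hx2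
      simp only [real_inner_smul_left] at hx2
      simp only [mul_sub, Finset.sum_sub_distrib, ← Finset.sum_mul, hw1, hx2]
      ring
    rw [Finset.sum_eq_zero_iff_of_nonneg (fun y hy => mul_nonneg (hw0 y hy)
      (sub_nonneg.2 (inner_le_supp P v (hSP y hy))))] at hx'
    classical
    have hfilter : ∀ g : E n → E n, ∑ y ∈ S.filter (fun y => w y ≠ 0), w y • g y
        = ∑ y ∈ S, w y • g y := fun g =>
      Finset.sum_filter_of_ne fun y _ h h0 => h (by rw [h0, zero_smul])
    rw [← hfilter fun y => y]
    refine (convex_convexHull ℝ _).sum_mem (fun y hy => hw0 y (Finset.mem_filter.1 hy).1) ?_ ?_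
    · rw [Finset.sum_filter_ne_zero, hw1]
    · intro y hy'
      obtain ⟨hy, hne⟩ := Finset.mem_filter.1 hy'
      apply subset_convexHull
      refine ⟨hy, ?_⟩
      rcases mul_eq_zero.1 (hx' y hy) with h | h
      · exact absurd h hne
      · linarith
  · refine convexHull_min ?_ ?_
    · rintro x ⟨hx, hxv⟩
      exact ⟨hSP x hx, hxv⟩
    · refine P.convex.inter ?_
      intro x hx y hy a b _ _ hab
      simp only [Set.mem_ofPred_eq] at *
      rw [inner_add_left, real_inner_smul_left, real_inner_smul_left, hx, hy, ← add_mul, hab,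
        one_mul]

/-- A polytope has only finitely many facet normals. -/
theorem facetNormals_finite {n : ℕ} {P : ConvexBody (E n)} (hP : IsPolytope (P : Set (E n))) :
    (facetNormals P).Finite := by
  classical
  obtain ⟨S, hS⟩ := hP
  let T : E n → Finset (E n) := fun v => S.filter fun x => inner ℝ x v = supp P v
  have hT : ∀ v, face P v = convexHull ℝ (T v : Set (E n)) := fun v => by
    rw [face_eq_convexHull hS v]
    congr 1
    ext x
    simp [T]
  refine Set.Finite.of_finite_fibers T ?_ ?_
  · exact (S.powerset.finite_toSet).subset (by
      rintro _ ⟨v, _, rfl⟩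
      exact Finset.mem_powerset.2 (Finset.filter_subset _ _))
  · rintro _ ⟨v, ⟨hv1, hv2⟩, rfl⟩
    refine (Set.toFinite ({v, -v} : Set (E n))).subset ?_
    rintro w ⟨⟨hw1, -⟩, hTw⟩
    have hface : face P w = face P v := by
      rw [hT, hT]
      have : T w = T v := hTw
      rw [this]
    have hperp : ∀ z : E n, face P z = face P v → z ∈ (vectorSpan ℝ (face P v))ᗮ := by
      intro z hz
      rw [Submodule.mem_orthogonal]
      intro y hy
      have hle : vectorSpan ℝ (face P v) ≤ LinearMap.ker (innerₛₗ ℝ z) := by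
        rw [vectorSpan_def, Submodule.span_le]
        rintro _ ⟨a, ha, b, hb, rfl⟩
        rw [← hz] at ha hb
        have ha2 : inner ℝ a z = supp P z := ha.2
        have hb2 : inner ℝ b z = supp P z := hb.2
        simp only [vsub_eq_sub, SetLike.mem_coe, LinearMap.mem_ker, map_sub, innerₛₗ_apply_apply]
        rw [real_inner_comm, real_inner_comm b z]
        rw [ha2, hb2, sub_self]
      have := hle hy
      rw [LinearMap.mem_ker, innerₛₗ_apply_apply] at this
      rw [real_inner_comm]
      exact this
    have hfr : Module.finrank ℝ (vectorSpan ℝ (face P v))ᗮ = 1 := by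
      have := (vectorSpan ℝ (face P v)).finrank_add_finrank_orthogonal
      rw [finrank_euclideanSpace_fin] at this
      omega
    have hv0 : v ≠ 0 := fun h => by simp [h] at hv1
    obtain ⟨c, hc⟩ := (finrank_eq_one_iff_of_nonzero'
      (⟨v, hperp v rfl⟩ : (vectorSpan ℝ (face P v))ᗮ)
      (by simpa [Subtype.ext_iff] using hv0)).1 hfr ⟨w, hperp w hface⟩
    have hc' : c • v = w := congrArg Subtype.val hc
    have hn : |c| = 1 := by
      rw [← hc', norm_smul, hv1, mul_one, Real.norm_eq_abs] at hw1
      exact hw1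
    rcases (abs_eq zero_le_one).1 hn with h | h
    · left
      rw [← hc', h, one_smul]
    · right
      rw [Set.mem_singleton_iff, ← hc', h, neg_one_smul]

/-- The sum over all facet normals `v` of `P` with `0 ∉ F(P, v)` of
`vol_{n-1}(F(P, v)) h(P, v)^{1-p} g(v)`. The measure `μHE[n - 1]` is the `(n-1)`-dimensional
Hausdorff measure, normalized to agree with Lebesgue measure on `(n-1)`-dimensional subspaces. -/
def facetSum {n : ℕ} (p : ℝ) (P : PolytopeO n) (g : E n → ℝ) : ℝ :=
  ∑ᶠ v ∈ {v ∈ facetNormals P.1 | (0 : E n) ∉ face P.1 v},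
    (μHE[n - 1] (face P.1 v)).toReal * supp P.1 v ^ (1 - p) * g v

theorem facetSum_nonneg {n : ℕ} (p : ℝ) (P : PolytopeO n) (g : E n → ℝ) (hg : ∀ v, 0 ≤ g v) :
    0 ≤ facetSum p P g := by
  refine finsum_nonneg fun v => finsum_nonneg fun _ => ?_
  exact mul_nonneg (mul_nonneg ENNReal.toReal_nonneg
    (Real.rpow_nonneg (supp_nonneg ⟨P.1, P.2.2⟩ v) _)) (hg v)

/-- The asymmetric `L_p`-projection body `Π_p^+ P`: the convex body with
`h(Π_p^+ P, u)^p = ∑ vol_{n-1}(F(P, v)) h(P, v)^{1-p} ⟨v, u⟩_+^p`, the sum extending over all facet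
normals `v` of `P` with `0 ∉ F(P, v)` (see `supp_projPlus`). -/
def projPlus {n : ℕ} (p : ℝ) (P : PolytopeO n) : BodyO n :=
  ofSupport (fun u => (facetSum p P fun v => max (inner ℝ v u) 0 ^ p) ^ (1 / p)) fun _ =>
    Real.rpow_nonneg (facetSum_nonneg p P _ fun _ => Real.rpow_nonneg (le_max_right _ _) _) _

/-- The asymmetric `L_p`-projection body `Π_p^- P`, defined as `Π_p^+ P` with the negative part
`⟨v, u⟩_- = max (-⟨v, u⟩) 0` in place of the positive part. -/
def projMinus {n : ℕ} (p : ℝ) (P : PolytopeO n) : BodyO n :=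
  ofSupport (fun u => (facetSum p P fun v => max (-inner ℝ v u) 0 ^ p) ^ (1 / p)) fun _ =>
    Real.rpow_nonneg (facetSum_nonneg p P _ fun _ => Real.rpow_nonneg (le_max_right _ _) _) _

theorem isSublinear_posPart {n : ℕ} (v : E n) :
    IsSublinear fun u : E n => max (inner ℝ v u) 0 where
  nonneg _ := le_max_right _ _
  add_le u w := by
    rw [inner_add_right]
    refine max_le (add_le_add (le_max_left _ _) (le_max_left _ _)) ?_
    exact add_nonneg (le_max_right _ _) (le_max_right _ _)
  smul_eq s hs u := by
    rw [real_inner_smul_right, mul_max_of_nonneg _ _ hs.le, mul_zero]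

theorem isSublinear_facetSum {n : ℕ} {p : ℝ} (hp : 1 < p) (P : PolytopeO n) (g : E n → E n → ℝ)
    (hg : ∀ v, IsSublinear (g v)) :
    IsSublinear fun u => (facetSum p P fun v => g v u ^ p) ^ (1 / p) := by
  have hfin : {v ∈ facetNormals P.1 | (0 : E n) ∉ face P.1 v}.Finite :=
    (facetNormals_finite P.2.1).subset fun v hv => hv.1
  have := isSublinear_lp hfin.toFinset hp.le
    (fun v => (μHE[n - 1] (face P.1 v)).toReal * supp P.1 v ^ (1 - p))
    (fun v _ => mul_nonneg ENNReal.toReal_nonneg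
      (Real.rpow_nonneg (supp_nonneg ⟨P.1, P.2.2⟩ v) _)) g fun v _ => hg v
  unfold facetSum
  simpa only [finsum_mem_eq_finite_toFinset_sum _ hfin] using this

theorem supp_projPlus {n : ℕ} {p : ℝ} (hp : 1 < p) (P : PolytopeO n) (u : E n) :
    supp (projPlus p P).1 u ^ p = facetSum p P fun v => max (inner ℝ v u) 0 ^ p := by
  have h := supp_ofSupport (isSublinear_facetSum hp P _ isSublinear_posPart) u
  unfold projPlus
  rw [h, ← Real.rpow_mul (facetSum_nonneg p P _ fun _ => Real.rpow_nonneg (le_max_right _ _) _),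
    one_div_mul_cancel (by linarith), Real.rpow_one]

theorem supp_projMinus {n : ℕ} {p : ℝ} (hp : 1 < p) (P : PolytopeO n) (u : E n) :
    supp (projMinus p P).1 u ^ p = facetSum p P fun v => max (-inner ℝ v u) 0 ^ p := by
  have h := supp_ofSupport (isSublinear_facetSum hp P (fun v u => max (-inner ℝ v u) 0)
    fun v => by simpa only [inner_neg_left] using isSublinear_posPart (-v)) u
  unfold projMinus
  rw [h, ← Real.rpow_mul (facetSum_nonneg p P _ fun _ => Real.rpow_nonneg (le_max_right _ _) _),
    one_div_mul_cancel (by linarith), Real.rpow_one]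

/-! ### Valuations and contravariance -/

/-- `Φ` is an `L_p`-Minkowski valuation: `Φ(P ∪ Q) +_p Φ(P ∩ Q) = Φ(P) +_p Φ(Q)` for all polytopes
`P, Q` containing the origin such that `P ∪ Q` and `P ∩ Q` are such polytopes as well. -/
def IsLpMinkowskiValuation {n : ℕ} (p : ℝ) (Φ : PolytopeO n → BodyO n) : Prop :=
  ∀ P Q U I : PolytopeO n,
    (U.1 : Set (E n)) = (P.1 : Set (E n)) ∪ (Q.1 : Set (E n)) →
    (I.1 : Set (E n)) = (P.1 : Set (E n)) ∩ (Q.1 : Set (E n)) →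
    lpSum p (Φ U) (Φ I) = lpSum p (Φ P) (Φ Q)

/-- `Φ` is `SL(n)`-contravariant: `Φ(φ P) = φ^{-t} Φ(P)` for all `P` and all `φ ∈ SL(n)`. -/
def IsSLContravariant {n : ℕ} (Φ : PolytopeO n → BodyO n) : Prop :=
  ∀ (φ : Matrix.SpecialLinearGroup (Fin n) ℝ) (P : PolytopeO n),
    Φ (P.map (Matrix.toEuclideanLin φ.1)) = (Φ P).map (Matrix.toEuclideanLin (φ⁻¹.1).transpose)

end LpMinkowski

end

/-!
Let `z P u = h(Φ P, u) ^ p` for an `SL(n)`-contravariant `L_p`-Minkowski valuation `Φ`. Each `z P`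
is nonnegative, continuous and positively homogeneous of degree `p`, it satisfies
`z (f P) (f u) = z P u` whenever `det f = 1`, and if a hyperplane `H` through the origin cuts `P`
into two parts, then `z P + z (P ∩ H)` is the sum of the values of `z` at these parts. The
classification uses nothing else; these properties are collected in `IsContraVal`.

*Simplicity.* If `P` lies in the hyperplane `v^⊥`, the shears along this hyperplane fix `P`. So
`z P u` depends only on `⟨v, u⟩` where this is nonzero, and by homogeneity and continuity it
vanishes where `⟨v, u⟩ = 0`. If `P` is orthogonal to two independent vectors, these facts together
give `z P = 0`; so `P ↦ z P v` is additive along cuts inside `v^⊥`. The halves of a simplex in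
`v^⊥`, cut along an edge that misses the origin, are images of the whole simplex under maps of
determinant `1` that double `v`. Hence the value on each half is `2 ^ (-p)` times the value on the
whole simplex, and since `2 * 2 ^ (-p) < 1`, these values are zero. By the uniqueness principle
below, `z P = 0` for all `P` in `v^⊥` (`IsContraVal.eq_zero_of_hyperplane`), and the term
`z (P ∩ H)` above may be dropped (`IsContraVal.eq_add`).

*Simplices.* For the simplex `φ T`, where `T` is the standard solid simplex and `φ` a linear
isomorphism, `z (φ T) (φ y)` depends only on `y` and the determinant of `φ`. Cutting `T` along an
edge that misses the origin gives two simplices of the same kind, and the resulting functional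
equation forces `z (φ T) (φ y) = |det φ| (k₁ (∑ yᵢ)₊ ^ p + k₂ (∑ yᵢ)₋ ^ p)`
(`IsContraVal.exists_simplex`). The condition `n ≥ 3` provides the edges needed here and above.

*Uniqueness.* A functional that is additive along cuts and vanishes on polytopes in hyperplanes
and on simplices with a vertex at the origin is zero (`eq_zero_of_simplex_eq_zero`), because every
polytope containing the origin can be cut into such pieces. So it is enough to compare `z` on
simplices with the facet sums that define the projection bodies.

*Facet sums.* Rescaling each facet normal `v` to `a = v / h(P, v)`, the facet sum becomes `n`
times the sum of `g a` weighted by the volumes of the cones over the facets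
(`facetSum_eq_coneSum`). In this form, the valuation property (`coneSum_valuation`), the
transformation rule under linear maps (`coneSum_image`) and the value on a simplex
(`coneSum_simplex`) are statements about volumes. This gives both the converse implication and the
comparison on simplices.
-/

open scoped Pointwise

namespace LpMinkowski

/-! ### Polytopes containing the origin and linear half-spaces -/

section Polytopes

variable {V W : Type*} [AddCommGroup V] [Module ℝ V] [AddCommGroup W] [Module ℝ W]

/-- A polytope containing the origin in a real vector space, as a set. -/
def IsPolyO (P : Set V) : Prop :=
  (0 : V) ∈ P ∧ ∃ S : Finset V, P = convexHull ℝ (S : Set V)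

theorem IsPolyO.image {P : Set V} (hP : IsPolyO P) (f : V →ₗ[ℝ] W) : IsPolyO (f '' P) := by
  classical
  obtain ⟨h0, S, rfl⟩ := hP
  exact ⟨⟨0, h0, map_zero f⟩, S.image f, by rw [Finset.coe_image, f.image_convexHull]⟩

theorem exists_convexHull_inter_nonneg_eq (S : Finset V) (l : Module.Dual ℝ V) :
    ∃ T : Finset V, convexHull ℝ (S : Set V) ∩ {x | 0 ≤ l x} = convexHull ℝ (T : Set V) := by
  classical
  set A := S.filter fun s => 0 ≤ l s with hA
  set B := S.filter fun s => ¬ 0 ≤ l s with hB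
  -- the point of the segment from `q.1` to `q.2` at which `l` vanishes
  let c : V × V → V := fun q => (l q.1 - l q.2)⁻¹ • ((-l q.2) • q.1 + l q.1 • q.2)
  have hc : ∀ q ∈ A ×ˢ B, c q ∈ segment ℝ q.1 q.2 ∧ l (c q) = 0 := by
    intro q hq
    obtain ⟨h1, h2⟩ := Finset.mem_product.1 hq
    have h1 : 0 ≤ l q.1 := (Finset.mem_filter.1 h1).2
    have h2 : l q.2 < 0 := not_le.1 (Finset.mem_filter.1 h2).2
    have hpos : 0 < l q.1 - l q.2 := by linarith
    refine ⟨⟨(l q.1 - l q.2)⁻¹ * (-l q.2), (l q.1 - l q.2)⁻¹ * l q.1, ?_, ?_, ?_, ?_⟩, ?_⟩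
    · exact mul_nonneg (inv_nonneg.2 hpos.le) (by linarith)
    · exact mul_nonneg (inv_nonneg.2 hpos.le) h1
    · field_simp; ring
    · simp only [c, smul_add, smul_smul]
    · simp only [c, map_smul, map_add, smul_eq_mul]; ring
  have hAc : ∀ a ∈ A, a ∈ S ∧ 0 ≤ l a := fun a ha => by simpa [hA] using ha
  have hBc : ∀ b ∈ B, b ∈ S ∧ l b < 0 := fun b hb => by simpa [hB] using hb
  refine ⟨A ∪ (A ×ˢ B).image c, Set.Subset.antisymm ?_ ?_⟩
  · rintro x ⟨hx, hlx⟩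
    rw [Finset.mem_convexHull'] at hx
    obtain ⟨w, hw0, hw1, rfl⟩ := hx
    set C := convexHull ℝ ((A ∪ (A ×ˢ B).image c : Finset V) : Set V) with hC
    have hAC : ∀ a ∈ A, a ∈ C := fun a ha => subset_convexHull ℝ _ (by simp [ha])
    have hcC : ∀ q ∈ A ×ˢ B, c q ∈ C := fun q hq => subset_convexHull ℝ _ (by
      rw [Finset.mem_coe]
      exact Finset.mem_union_right _ (Finset.mem_image_of_mem _ hq))
    have hsplit : ∀ g : V → ℝ, ∑ s ∈ S, g s = ∑ s ∈ A, g s + ∑ s ∈ B, g s := fun g =>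
      (Finset.sum_filter_add_sum_filter_not S _ g).symm
    have hsplitV : ∀ g : V → V, ∑ s ∈ S, g s = ∑ s ∈ A, g s + ∑ s ∈ B, g s := fun g =>
      (Finset.sum_filter_add_sum_filter_not S _ g).symm
    have hwA : ∀ a ∈ A, 0 ≤ w a := fun a ha => hw0 a (hAc a ha).1
    have hwB : ∀ b ∈ B, 0 ≤ w b := fun b hb => hw0 b (hBc b hb).1
    set α := ∑ a ∈ A, w a * l a with hα
    set β := ∑ b ∈ B, w b * (-l b) with hβ
    have hα0 : 0 ≤ α := Finset.sum_nonneg fun a ha => mul_nonneg (hwA a ha) (hAc a ha).2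
    have hβ0 : 0 ≤ β := Finset.sum_nonneg fun b hb =>
      mul_nonneg (hwB b hb) (by linarith [(hBc b hb).2])
    have hαβ : β ≤ α := by
      have h : 0 ≤ l (∑ s ∈ S, w s • s) := hlx
      simp only [map_sum, map_smul, smul_eq_mul] at h
      rw [hsplit] at h
      have : β = -∑ b ∈ B, w b * l b := by rw [hβ]; simp
      linarith
    rcases hβ0.eq_or_lt with hβz | hβpos
    · have hz : ∀ b ∈ B, w b = 0 := by
        intro b hb
        have := (Finset.sum_eq_zero_iff_of_nonneg (fun b hb =>
          mul_nonneg (hwB b hb) (by linarith [(hBc b hb).2]))).1 hβz.symm b hb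
        rcases mul_eq_zero.1 this with h | h
        · exact h
        · linarith [(hBc b hb).2]
      rw [hsplitV, Finset.sum_eq_zero (s := B) fun b hb => by rw [hz b hb, zero_smul], add_zero]
      rw [hsplit, Finset.sum_eq_zero (s := B) fun b hb => hz b hb, add_zero] at hw1
      exact (convex_convexHull ℝ _).sum_mem hwA hw1 hAC
    · have hαpos : 0 < α := hβpos.trans_le hαβ
      -- move all the mass of the negative points to crossing points
      let ω : (V × V) ⊕ V → ℝ := Sum.elim
        (fun q => α⁻¹ * (w q.1 * w q.2 * (l q.1 - l q.2))) fun a => (1 - β / α) * w a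
      let ζ : (V × V) ⊕ V → V := Sum.elim c id
      have hsmul : ∀ q ∈ A ×ˢ B, (α⁻¹ * (w q.1 * w q.2 * (l q.1 - l q.2))) • c q
          = α⁻¹ • ((w q.2 * -l q.2) • w q.1 • q.1 + (w q.1 * l q.1) • w q.2 • q.2) := by
        intro q hq
        obtain ⟨h1, h2⟩ := Finset.mem_product.1 hq
        have hpos : l q.1 - l q.2 ≠ 0 := by linarith [(hAc _ h1).2, (hBc _ h2).2]
        simp only [c, smul_add, smul_smul]
        congr 2 <;> field_simp
      have hω0 : ∀ k ∈ (A ×ˢ B).disjSum A, 0 ≤ ω k := by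
        intro k hk
        rcases Finset.mem_disjSum.1 hk with ⟨q, hq, rfl⟩ | ⟨a, ha, rfl⟩
        · obtain ⟨h1, h2⟩ := Finset.mem_product.1 hq
          exact mul_nonneg (inv_nonneg.2 hα0) (mul_nonneg (mul_nonneg (hwA _ h1) (hwB _ h2))
            (by linarith [(hAc _ h1).2, (hBc _ h2).2]))
        · exact mul_nonneg (sub_nonneg.2 ((div_le_one hαpos).2 hαβ)) (hwA a ha)
      have hω1 : ∑ k ∈ (A ×ˢ B).disjSum A, ω k = 1 := by
        rw [Finset.sum_disjSum]
        simp only [ω, Sum.elim_inl, Sum.elim_inr]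
        rw [← Finset.mul_sum, ← Finset.mul_sum, Finset.sum_product]
        have : ∑ a ∈ A, ∑ b ∈ B, w a * w b * (l a - l b)
            = α * ∑ b ∈ B, w b + β * ∑ a ∈ A, w a := by
          rw [hα, hβ, Finset.sum_mul_sum, mul_comm, Finset.sum_mul_sum, ← Finset.sum_add_distrib]
          refine Finset.sum_congr rfl fun a _ => ?_
          rw [← Finset.sum_add_distrib]
          exact Finset.sum_congr rfl fun b _ => by ring
        rw [this]
        rw [hsplit] at hw1
        field_simp
        linear_combination α * hw1
      have hωζ : ∑ k ∈ (A ×ˢ B).disjSum A, ω k • ζ k = ∑ s ∈ S, w s • s := by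
        rw [Finset.sum_disjSum, hsplitV]
        simp only [ω, ζ, Sum.elim_inl, Sum.elim_inr, id]
        rw [Finset.sum_congr rfl hsmul, ← Finset.smul_sum, Finset.sum_product]
        have : ∑ a ∈ A, ∑ b ∈ B, ((w b * -l b) • w a • a + (w a * l a) • w b • b)
            = β • ∑ a ∈ A, w a • a + α • ∑ b ∈ B, w b • b := by
          simp only [Finset.sum_add_distrib]
          congr 1
          · rw [Finset.smul_sum]
            exact Finset.sum_congr rfl fun a _ => by rw [hβ, Finset.sum_smul]
          · rw [hα, Finset.sum_smul]
            exact Finset.sum_congr rfl fun a _ => by rw [Finset.smul_sum]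
        rw [this]
        simp only [mul_smul, ← Finset.smul_sum]
        rw [smul_add, smul_smul, smul_smul, inv_mul_cancel₀ hαpos.ne', one_smul, sub_smul, one_smul,
          div_eq_inv_mul]
        abel
      rw [← hωζ]
      refine (convex_convexHull ℝ _).sum_mem hω0 hω1 ?_
      intro k hk
      rcases Finset.mem_disjSum.1 hk with ⟨q, hq, rfl⟩ | ⟨a, ha, rfl⟩
      · exact hcC q hq
      · exact hAC a ha
  · refine convexHull_min ?_ ((convex_convexHull ℝ _).inter (convex_halfSpace_ge l.isLinear 0))
    intro x hx
    rw [Finset.mem_coe, Finset.mem_union, Finset.mem_image] at hx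
    rcases hx with hx | ⟨q, hq, rfl⟩
    · exact ⟨subset_convexHull ℝ _ (hAc x hx).1, (hAc x hx).2⟩
    · obtain ⟨h1, h2⟩ := Finset.mem_product.1 hq
      exact ⟨(convex_convexHull ℝ _).segment_subset (subset_convexHull ℝ _ (hAc _ h1).1)
        (subset_convexHull ℝ _ (hBc _ h2).1) (hc q hq).1, (hc q hq).2.ge⟩

theorem IsPolyO.inter_nonneg {P : Set V} (hP : IsPolyO P) (l : Module.Dual ℝ V) :
    IsPolyO (P ∩ {x | 0 ≤ l x}) := by
  obtain ⟨h0, S, rfl⟩ := hP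
  exact ⟨⟨h0, by simp⟩, exists_convexHull_inter_nonneg_eq S l⟩

theorem IsPolyO.inter_nonpos {P : Set V} (hP : IsPolyO P) (l : Module.Dual ℝ V) :
    IsPolyO (P ∩ {x | l x ≤ 0}) := by
  simpa using hP.inter_nonneg (-l)

theorem IsPolyO.inter_eq_zero {P : Set V} (hP : IsPolyO P) (l : Module.Dual ℝ V) :
    IsPolyO (P ∩ {x | l x = 0}) := by
  have := (hP.inter_nonneg l).inter_nonpos l
  convert this using 1
  ext x
  simp only [Set.mem_inter_iff, Set.mem_ofPred_eq, le_antisymm_iff]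
  tauto

theorem IsPolyO.inter_forall_nonneg {P : Set V} (hP : IsPolyO P) {κ : Type*} (s : Finset κ)
    (l : κ → Module.Dual ℝ V) : IsPolyO (P ∩ {x | ∀ k ∈ s, 0 ≤ l k x}) := by
  classical
  induction s using Finset.induction_on with
  | empty => simpa using hP
  | insert a s _ ih =>
    convert ih.inter_nonneg (l a) using 1
    ext x
    simp only [Finset.forall_mem_insert, Set.mem_inter_iff, Set.mem_ofPred_eq]
    tauto

/-- Fourier–Motzkin elimination: a finitely generated cone is an intersection of finitely many
half-spaces. -/
theorem exists_finset_dual_of_cone [FiniteDimensional ℝ W] {κ : Type*} (v : κ → W)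
    (s : Finset κ) : ∃ F : Finset (Module.Dual ℝ W), ∀ x : W,
      (∃ c : κ → ℝ, (∀ k ∈ s, 0 ≤ c k) ∧ ∑ k ∈ s, c k • v k = x) ↔ ∀ f ∈ F, 0 ≤ f x := by
  classical
  induction s using Finset.induction_on with
  | empty =>
    let b := Module.finBasis ℝ W
    refine ⟨Finset.univ.image b.coord ∪ Finset.univ.image fun i => -b.coord i, fun x => ?_⟩
    simp only [Finset.notMem_empty, false_imp_iff, implies_true, Finset.sum_empty, true_and,
      exists_const, Finset.mem_union, Finset.mem_image, Finset.mem_univ]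
    constructor
    · rintro rfl f -
      simp
    · intro h
      refine (b.ext_elem fun i => ?_).symm
      have h1 := h (b.coord i) (Or.inl ⟨i, rfl⟩)
      have h2 := h (-b.coord i) (Or.inr ⟨i, rfl⟩)
      simp at h1 h2 ⊢
      linarith
  | insert a s ha ih =>
    obtain ⟨F, hF⟩ := ih
    have key : ∀ x, (∃ c : κ → ℝ, (∀ k ∈ insert a s, 0 ≤ c k) ∧ ∑ k ∈ insert a s, c k • v k = x) ↔
        ∃ t : ℝ, 0 ≤ t ∧ ∀ f ∈ F, 0 ≤ f (x - t • v a) := by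
      intro x
      constructor
      · rintro ⟨c, hc, hx⟩
        rw [Finset.sum_insert ha] at hx
        refine ⟨c a, hc a (Finset.mem_insert_self _ _), (hF _).1 ⟨c, fun k hk =>
          hc k (Finset.mem_insert_of_mem hk), ?_⟩⟩
        rw [← hx, add_sub_cancel_left]
      · rintro ⟨t, ht, h⟩
        obtain ⟨c, hc, hx⟩ := (hF _).2 h
        refine ⟨Function.update c a t, fun k hk => ?_, ?_⟩
        · rcases eq_or_ne k a with rfl | hka
          · simpa using ht
          · rw [Function.update_of_ne hka]
            exact hc k (Finset.mem_of_mem_insert_of_ne hk hka)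
        · rw [Finset.sum_insert ha, Function.update_self, Finset.sum_congr rfl fun k hk => by
            rw [Function.update_of_ne (ne_of_mem_of_not_mem hk ha)], hx, add_sub_cancel]
    refine ⟨F.filter (fun f => 0 ≤ f (v a)) ∪ ((F.filter fun f => 0 < f (v a)) ×ˢ
      (F.filter fun f => f (v a) < 0)).image fun q => q.1 (v a) • q.2 - q.2 (v a) • q.1,
      fun x => ?_⟩
    rw [key]
    simp only [Finset.mem_union, Finset.mem_filter, Finset.mem_image, Finset.mem_product]
    constructor
    · rintro ⟨t, ht, h⟩ f (⟨hf, hfv⟩ | ⟨q, ⟨⟨hq1, hp⟩, hq2, hn⟩, rfl⟩)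
      · have := h f hf
        rw [map_sub, map_smul, smul_eq_mul] at this
        nlinarith [mul_nonneg ht hfv]
      · have h1 := h _ hq1
        have h2 := h _ hq2
        simp only [map_sub, map_smul, smul_eq_mul] at h1 h2
        simp only [LinearMap.sub_apply, LinearMap.smul_apply, smul_eq_mul]
        nlinarith [mul_nonneg hp.le h2, mul_nonneg (neg_nonneg.2 hn.le) h1]
    · intro h
      -- the largest of the lower bounds imposed on `t`
      obtain ⟨t, ht0, htF, ht⟩ : ∃ t : ℝ, 0 ≤ t ∧ (∀ f ∈ F, f (v a) < 0 → f x / f (v a) ≤ t) ∧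
          (t = 0 ∨ ∃ g ∈ F, g (v a) < 0 ∧ t = g x / g (v a)) := by
        let N := F.filter fun f => f (v a) < 0
        by_cases hN : ∃ g ∈ N, 0 ≤ g x / g (v a)
        · obtain ⟨g0, hg0, hg0'⟩ := hN
          obtain ⟨g, hg, hmax⟩ := N.exists_max_image (fun f => f x / f (v a)) ⟨g0, hg0⟩
          refine ⟨_, hg0'.trans (hmax g0 hg0), fun f hf hfv => hmax f ?_, Or.inr ⟨g, ?_, ?_, rfl⟩⟩
          · exact Finset.mem_filter.2 ⟨hf, hfv⟩
          · exact (Finset.mem_filter.1 hg).1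
          · exact (Finset.mem_filter.1 hg).2
        · push Not at hN
          exact ⟨0, le_rfl, fun f hf hfv => (hN f (Finset.mem_filter.2 ⟨hf, hfv⟩)).le, Or.inl rfl⟩
      refine ⟨t, ht0, fun f hf => ?_⟩
      rw [map_sub, map_smul, smul_eq_mul]
      rcases lt_or_ge (f (v a)) 0 with hfv | hfv
      · have := htF f hf hfv
        rw [div_le_iff_of_neg hfv] at this
        linarith
      · rcases ht with rfl | ⟨g, hg, hgv, rfl⟩
        · have := h f (Or.inl ⟨hf, hfv⟩)
          linarith
        · rcases hfv.eq_or_lt with hfz | hfp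
          · have := h f (Or.inl ⟨hf, hfv⟩)
            rw [← hfz]
            linarith
          · have := h _ (Or.inr ⟨(f, g), ⟨⟨hf, hfp⟩, hg, hgv⟩, rfl⟩)
            simp only [LinearMap.sub_apply, LinearMap.smul_apply, smul_eq_mul] at this
            rw [sub_nonneg, div_mul_eq_mul_div, div_le_iff_of_neg hgv]
            linarith

/-- A polytope containing the origin is cut out by inequalities with right-hand sides `1`
and `0`. -/
theorem IsPolyO.exists_halfSpaces [FiniteDimensional ℝ V] {P : Set V} (hP : IsPolyO P) :
    ∃ A B : Finset (Module.Dual ℝ V),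
      P = {x | (∀ a ∈ A, a x ≤ 1) ∧ ∀ b ∈ B, b x ≤ 0} := by
  classical
  obtain ⟨h0, S, rfl⟩ := hP
  obtain ⟨F, hF⟩ := exists_finset_dual_of_cone (fun s : V => (s, (1 : ℝ))) S
  have hmem : ∀ x, x ∈ convexHull ℝ (S : Set V) ↔ ∀ f ∈ F, 0 ≤ f (x, 1) := by
    intro x
    rw [← hF, Finset.mem_convexHull']
    refine exists_congr fun c => and_congr_right fun _ => ?_
    simp only [Prod.ext_iff, Prod.fst_sum, Prod.snd_sum, Prod.smul_mk, smul_eq_mul, mul_one]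
    tauto
  -- the functional `x ↦ f (x, 0)`; the constant term `f (0, 1)` is nonnegative as `0 ∈ P`
  let r : Module.Dual ℝ (V × ℝ) → Module.Dual ℝ V := fun f => f ∘ₗ LinearMap.inl ℝ V ℝ
  have hr : ∀ f x, f (x, (1 : ℝ)) = r f x + f (0, 1) := by
    intro f x
    simp only [r, LinearMap.comp_apply, LinearMap.inl_apply, ← map_add]
    simp
  refine ⟨(F.filter fun f => 0 < f (0, 1)).image fun f => -(f (0, 1))⁻¹ • r f,
    (F.filter fun f => f (0, 1) = 0).image fun f => -r f, ?_⟩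
  ext x
  simp only [hmem, Set.mem_ofPred_eq, Finset.forall_mem_image, Finset.mem_filter, and_imp,
    LinearMap.smul_apply, LinearMap.neg_apply, smul_eq_mul, neg_nonpos]
  have h0F := (hmem 0).1 h0
  constructor
  · intro h
    refine ⟨fun f hf hpos => ?_, fun f hf hz => ?_⟩
    · have := h f hf
      rw [hr] at this
      rw [neg_mul, inv_mul_eq_div, neg_le, le_div_iff₀ hpos]
      linarith
    · have := h f hf
      rwa [hr, hz, add_zero] at this
  · rintro ⟨h1, h2⟩ f hf
    rw [hr]
    rcases (h0F f hf).eq_or_lt with hz | hpos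
    · rw [← hz, add_zero]
      exact h2 hf hz.symm
    · have := h1 hf hpos
      rw [neg_mul, inv_mul_eq_div, neg_le, le_div_iff₀ hpos] at this
      linarith

end Polytopes

/-! ### Simplicial cones and cuts along an edge -/

section EdgeCuts

variable {ι : Type*} [DecidableEq ι]

/-- The linear map of `ℝ^ι` sending `e j` to `c e_i + (1 - c) e_j` and fixing the other unit
vectors. -/
def edgeMap (i j : ι) (c : ℝ) : (ι → ℝ) →ₗ[ℝ] (ι → ℝ) :=
  LinearMap.transvection (LinearMap.proj j) (c • (Pi.single i 1 - Pi.single j 1))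

theorem edgeMap_apply_left {i j : ι} (hij : i ≠ j) (c : ℝ) (y : ι → ℝ) :
    edgeMap i j c y i = y i + c * y j := by
  simp [edgeMap, LinearMap.transvection.apply, hij]
  ring

theorem edgeMap_apply_right {i j : ι} (hij : i ≠ j) (c : ℝ) (y : ι → ℝ) :
    edgeMap i j c y j = (1 - c) * y j := by
  simp [edgeMap, LinearMap.transvection.apply, hij.symm]
  ring

theorem edgeMap_apply_of_ne {i j k : ι} (hki : k ≠ i) (hkj : k ≠ j) (c : ℝ) (y : ι → ℝ) :
    edgeMap i j c y k = y k := by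
  simp [edgeMap, LinearMap.transvection.apply, hki, hkj]

theorem det_edgeMap [Fintype ι] {i j : ι} (hij : i ≠ j) (c : ℝ) :
    LinearMap.det (edgeMap i j c) = 1 - c := by
  rw [edgeMap, LinearMap.transvection.det]
  simp [hij.symm]
  ring

theorem sum_edgeMap [Fintype ι] {i j : ι} (c : ℝ) (y : ι → ℝ) :
    ∑ k, edgeMap i j c y k = ∑ k, y k := by
  simp [edgeMap, LinearMap.transvection.apply, Finset.sum_add_distrib, ← Finset.mul_sum]

theorem edgeMap_comp {i j : ι} (hij : i ≠ j) (c d : ℝ) (h : (1 - c) * (1 - d) = 1) :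
    edgeMap i j c ∘ₗ edgeMap i j d = LinearMap.id := by
  refine LinearMap.ext fun y => funext fun k => ?_
  simp only [LinearMap.comp_apply, LinearMap.id_apply]
  rcases eq_or_ne k i with rfl | hki
  · rw [edgeMap_apply_left hij, edgeMap_apply_left hij, edgeMap_apply_right hij]
    linear_combination -y j * h
  · rcases eq_or_ne k j with rfl | hkj
    · rw [edgeMap_apply_right hij, edgeMap_apply_right hij]
      linear_combination y k * h
    · rw [edgeMap_apply_of_ne hki hkj, edgeMap_apply_of_ne hki hkj]

/-- `edgeMap` as an equivalence, for `c ≠ 1`. -/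
noncomputable def edgeEquiv {i j : ι} (hij : i ≠ j) {c : ℝ} (hc : c ≠ 1) : (ι → ℝ) ≃ₗ[ℝ] (ι → ℝ) :=
  LinearEquiv.ofLinearMap (edgeMap i j c) (edgeMap i j (-c / (1 - c)))
    (edgeMap_comp hij _ _ (by have := sub_ne_zero.2 hc.symm; field_simp; ring))
    (edgeMap_comp hij _ _ (by have := sub_ne_zero.2 hc.symm; field_simp; ring))

@[simp]
theorem edgeEquiv_apply {i j : ι} (hij : i ≠ j) {c : ℝ} (hc : c ≠ 1) (y : ι → ℝ) :
    edgeEquiv hij hc y = edgeMap i j c y := rfl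

/-- The nonnegative orthant. -/
def orthant (ι : Type*) : Set (ι → ℝ) := {y | ∀ i, 0 ≤ y i}

/-- The simplex with vertices `0` and the unit vectors. -/
def stdSolid (ι : Type*) [Fintype ι] : Set (ι → ℝ) := {y | (∀ i, 0 ≤ y i) ∧ ∑ i, y i ≤ 1}

theorem image_edgeEquiv_trans {V : Type*} [AddCommGroup V] [Module ℝ V] {i j : ι} (hij : i ≠ j)
    {c : ℝ} (hc : c ≠ 1) (φ : (ι → ℝ) ≃ₗ[ℝ] V) (S : Set (ι → ℝ)) :
    ((edgeEquiv hij hc).trans φ) '' S = φ '' (edgeMap i j c '' S) := by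
  rw [Set.image_image]
  rfl

theorem edgeMap_mem_orthant_iff {i j : ι} (hij : i ≠ j) {c : ℝ} (h0 : 0 ≤ c) (h1 : c < 1)
    (y : ι → ℝ) : y ∈ orthant ι ↔
      edgeMap i j c y ∈ orthant ι ∧ c * edgeMap i j c y j ≤ (1 - c) * edgeMap i j c y i := by
  have hc : 0 < 1 - c := by linarith
  simp only [orthant, Set.mem_ofPred_eq]
  rw [edgeMap_apply_left hij, edgeMap_apply_right hij]
  constructor
  · intro h
    refine ⟨fun k => ?_, by nlinarith [h i, h j]⟩
    rcases eq_or_ne k i with rfl | hki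
    · rw [edgeMap_apply_left hij]
      exact add_nonneg (h k) (mul_nonneg h0 (h j))
    · rcases eq_or_ne k j with rfl | hkj
      · rw [edgeMap_apply_right hij]
        exact mul_nonneg hc.le (h k)
      · rw [edgeMap_apply_of_ne hki hkj]
        exact h k
  · rintro ⟨h, hle⟩ k
    rcases eq_or_ne k i with rfl | hki
    · have : 0 ≤ (1 - c) * y k := by linarith
      exact nonneg_of_mul_nonneg_right this hc
    · rcases eq_or_ne k j with rfl | hkj
      · have := h k
        rw [edgeMap_apply_right hij] at this
        exact nonneg_of_mul_nonneg_right this hc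
      · have := h k
        rwa [edgeMap_apply_of_ne hki hkj] at this

theorem image_edgeMap_orthant {i j : ι} (hij : i ≠ j) {c : ℝ} (h0 : 0 ≤ c) (h1 : c < 1) :
    edgeMap i j c '' orthant ι = orthant ι ∩ {y | c * y j ≤ (1 - c) * y i} := by
  ext x
  obtain ⟨y, rfl⟩ := (edgeEquiv hij h1.ne).surjective x
  rw [edgeEquiv_apply]
  have hinj : Function.Injective (edgeMap i j c) := (edgeEquiv hij h1.ne).injective
  rw [hinj.mem_set_image, edgeMap_mem_orthant_iff hij h0 h1]
  rfl

theorem image_edgeMap_stdSolid [Fintype ι] {i j : ι} (hij : i ≠ j) {c : ℝ} (h0 : 0 ≤ c)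
    (h1 : c < 1) :
    edgeMap i j c '' stdSolid ι = stdSolid ι ∩ {y | c * y j ≤ (1 - c) * y i} := by
  ext x
  obtain ⟨y, rfl⟩ := (edgeEquiv hij h1.ne).surjective x
  rw [edgeEquiv_apply]
  have hinj : Function.Injective (edgeMap i j c) := (edgeEquiv hij h1.ne).injective
  have h := edgeMap_mem_orthant_iff hij h0 h1 y
  simp only [orthant, Set.mem_ofPred_eq] at h
  rw [hinj.mem_set_image]
  simp only [stdSolid, Set.mem_ofPred_eq, Set.mem_inter_iff, sum_edgeMap, h]
  tauto

theorem stdSolid_eq_convexHull [Fintype ι] :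
    stdSolid ι = convexHull ℝ (insert 0 (Set.range fun i => Pi.single i (1 : ℝ))) := by
  apply Set.Subset.antisymm
  · rintro y ⟨h0, h1⟩
    -- the vertex `0` takes up the mass missing to `1`
    have h := (convex_convexHull ℝ (insert (0 : ι → ℝ) (Set.range fun i => Pi.single i (1 : ℝ)))
      ).sum_mem (t := Finset.univ) (w := fun o : Option ι => o.elim (1 - ∑ i, y i) y)
      (z := fun o : Option ι => o.elim 0 fun i => Pi.single i 1) ?_ ?_ ?_
    · rw [Fintype.sum_option] at h
      simp only [Option.elim, smul_zero, zero_add] at h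
      convert h using 1
      ext k
      simp [Finset.sum_apply, Pi.single_apply]
    · rintro (_ | i) -
      · simpa using h1
      · exact h0 i
    · rw [Fintype.sum_option]
      simp
    · rintro (_ | i) -
      · exact subset_convexHull ℝ _ (by simp)
      · exact subset_convexHull ℝ _ (by simp)
  · refine convexHull_min ?_ ?_
    · rintro _ (rfl | ⟨i, rfl⟩)
      · simp [stdSolid]
      · refine ⟨fun k => ?_, by simp⟩
        change 0 ≤ (Pi.single i 1 : ι → ℝ) k
        rw [Pi.single_apply]
        split_ifs <;> simp
    · intro x hx y hy a b ha hb hab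
      refine ⟨fun i => ?_, ?_⟩
      · exact add_nonneg (mul_nonneg ha (hx.1 i)) (mul_nonneg hb (hy.1 i))
      · simp only [Pi.add_apply, Pi.smul_apply, smul_eq_mul, Finset.sum_add_distrib,
          ← Finset.mul_sum]
        nlinarith [mul_le_mul_of_nonneg_left hx.2 ha, mul_le_mul_of_nonneg_left hy.2 hb]

theorem isPolyO_stdSolid [Fintype ι] : IsPolyO (stdSolid ι) := by
  classical
  refine ⟨by simp [stdSolid], insert 0 (Finset.univ.image fun i => Pi.single i (1 : ℝ)), ?_⟩
  rw [stdSolid_eq_convexHull]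
  simp

end EdgeCuts

/-! ### Simple functionals vanishing on simplices -/

section Vanishing

variable {ι : Type*}
variable {V : Type*} [NormedAddCommGroup V] [NormedSpace ℝ V]

theorem mem_image_orthant {φ : (ι → ℝ) ≃ₗ[ℝ] V} {x : V} :
    x ∈ φ '' orthant ι ↔ ∀ i, 0 ≤ φ.symm x i := by
  rw [LinearEquiv.image_eq_preimage_symm]
  rfl

variable [Fintype ι] [DecidableEq ι]

theorem apply_eq_sum_single (φ : (ι → ℝ) ≃ₗ[ℝ] V) (l : Module.Dual ℝ V) (x : V) :
    l x = ∑ i, φ.symm x i * l (φ (Pi.single i 1)) := by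
  have : x = ∑ i, φ.symm x i • φ (Pi.single i 1) := by
    conv_lhs => rw [← φ.apply_symm_apply x, pi_eq_sum_univ' (φ.symm x)]
    rw [map_sum]
    refine Finset.sum_congr rfl fun i _ => ?_
    rw [map_smul]
  conv_lhs => rw [this, map_sum]
  simp

/-- A linear functional has constant sign on a set. -/
def ConstSign (l : Module.Dual ℝ V) (C : Set V) : Prop :=
  (∀ x ∈ C, 0 ≤ l x) ∨ ∀ x ∈ C, l x ≤ 0

/-- Cutting a simplicial cone along edges until the functionals of a given list have constant sign
on each piece. -/
theorem simplicialCone_induction (good : ((ι → ℝ) ≃ₗ[ℝ] V) → Prop)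
    (hcut : ∀ (φ : (ι → ℝ) ≃ₗ[ℝ] V) (i j : ι) (hij : i ≠ j) (c : ℝ) (h0 : 0 < c) (h1 : c < 1),
      good ((edgeEquiv hij h1.ne).trans φ) →
      good ((edgeEquiv hij.symm (by linarith : 1 - c ≠ 1)).trans φ) → good φ)
    (L : List (Module.Dual ℝ V)) :
    ∀ φ : (ι → ℝ) ≃ₗ[ℝ] V,
      (∀ ψ : (ι → ℝ) ≃ₗ[ℝ] V, (∀ l ∈ L, ConstSign l (ψ '' orthant ι)) → good ψ) → good φ := by
  have hsub : ∀ (φ : (ι → ℝ) ≃ₗ[ℝ] V) (i j : ι) (hij : i ≠ j) (c : ℝ) (_ : 0 ≤ c) (h1 : c < 1),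
      ((edgeEquiv hij h1.ne).trans φ) '' orthant ι ⊆ φ '' orthant ι := by
    intro φ i j hij c h0 h1
    rintro _ ⟨y, hy, rfl⟩
    exact ⟨_, ((edgeMap_mem_orthant_iff hij h0 h1 y).1 hy).1, rfl⟩
  -- the hypothesis may be restricted to subcones of the given cone
  suffices H : ∀ φ : (ι → ℝ) ≃ₗ[ℝ] V, (∀ ψ : (ι → ℝ) ≃ₗ[ℝ] V, ψ '' orthant ι ⊆ φ '' orthant ι →
      (∀ l ∈ L, ConstSign l (ψ '' orthant ι)) → good ψ) → good φ from
    fun φ h => H φ fun ψ _ => h ψ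
  induction L with
  | nil => exact fun φ h => h φ subset_rfl (by simp)
  | cons l L ih =>
    intro φ h
    refine ih φ fun ψ hψ hL => ?_
    clear ih
    -- induction on the number of generators at which `l` does not vanish
    induction hm : (Finset.univ.filter fun k => l (ψ (Pi.single k 1)) ≠ 0).card
      using Nat.strong_induction_on generalizing ψ with
    | _ m ihm =>
      by_cases hex : ∃ i j, 0 < l (ψ (Pi.single i 1)) ∧ l (ψ (Pi.single j 1)) < 0
      · obtain ⟨i, j, hi, hj⟩ := hex
        have hij : i ≠ j := by rintro rfl; linarith
        set p := l (ψ (Pi.single i 1)) with hp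
        set q := l (ψ (Pi.single j 1)) with hq
        have hpq : 0 < p - q := by linarith
        set c := -q / (p - q) with hc
        have h0 : 0 < c := div_pos (by linarith) hpq
        have h1 : c < 1 := (div_lt_one hpq).2 (by linarith)
        -- both pieces have the crossing point of the edge as a generator, where `l` vanishes
        have step : ∀ (i' j' : ι) (hij' : i' ≠ j') (d : ℝ) (_ : 0 < d) (hd1 : d < 1),
            l (ψ (Pi.single j' 1)) ≠ 0 →
            d * l (ψ (Pi.single i' 1)) + (1 - d) * l (ψ (Pi.single j' 1)) = 0 →
            good ((edgeEquiv hij' hd1.ne).trans ψ) := by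
          intro i' j' hij' d hd0 hd1 hne hzero
          have hs := hsub ψ i' j' hij' d hd0.le hd1
          refine ihm _ ?_ _ (hs.trans hψ) ?_ rfl
          · rw [← hm]
            refine Finset.card_lt_card ?_
            have hE : ∀ k, l ((edgeEquiv hij' hd1.ne).trans ψ (Pi.single k 1))
                = if k = j' then 0 else l (ψ (Pi.single k 1)) := by
              intro k
              rw [LinearEquiv.trans_apply, edgeEquiv_apply, edgeMap,
                LinearMap.transvection.apply]
              simp only [LinearMap.proj_apply, map_add, map_smul, map_sub, smul_eq_mul]
              split_ifs with hk
              · subst hk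
                simp
                linarith
              · simp [Ne.symm hk]
            rw [Finset.ssubset_iff_of_subset]
            · refine ⟨j', by simp [hne], ?_⟩
              rw [Finset.mem_filter, hE]
              simp
            · intro k
              simp only [Finset.mem_filter, Finset.mem_univ, true_and, hE]
              split_ifs <;> simp
          · intro l' hl'
            rcases hL l' hl' with h' | h'
            · exact Or.inl fun x hx => h' x (hs hx)
            · exact Or.inr fun x hx => h' x (hs hx)
        refine hcut ψ i j hij c h0 h1 (step i j hij c h0 h1 hj.ne ?_)
          (step j i hij.symm (1 - c) (by linarith) (by linarith) hi.ne' ?_)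
        · rw [← hp, ← hq, hc]
          field_simp
          ring
        · rw [← hp, ← hq, hc]
          field_simp
          ring
      · refine h ψ hψ ?_
        rw [List.forall_mem_cons]
        refine ⟨?_, hL⟩
        push Not at hex
        by_cases hpos : ∃ i, 0 < l (ψ (Pi.single i 1))
        · obtain ⟨i, hi⟩ := hpos
          refine Or.inl fun x hx => ?_
          rw [apply_eq_sum_single ψ]
          exact Finset.sum_nonneg fun k _ => mul_nonneg (mem_image_orthant.1 hx k) (hex i k hi)
        · push Not at hpos
          refine Or.inr fun x hx => ?_
          rw [apply_eq_sum_single ψ]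
          exact Finset.sum_nonpos fun k _ =>
            mul_nonpos_of_nonneg_of_nonpos (mem_image_orthant.1 hx k) (hpos k)

/-- A polytope containing the origin meets a sufficiently small simplicial cone either in a set of
lower dimension or in a simplex. -/
theorem IsPolyO.inter_simplicialCone {P : Set V} (hP : IsPolyO P) {A B : Finset (Module.Dual ℝ V)}
    (hAB : P = {x | (∀ a ∈ A, a x ≤ 1) ∧ ∀ b ∈ B, b x ≤ 0}) (φ : (ι → ℝ) ≃ₗ[ℝ] V)
    (hA : ∀ a ∈ A, ∀ a' ∈ A, ConstSign (a - a') (φ '' orthant ι)) (hA0 : (0 : Module.Dual ℝ V) ∈ A)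
    (hB : ∀ b ∈ B, ConstSign b (φ '' orthant ι)) :
    (∃ b : Module.Dual ℝ V, b ≠ 0 ∧ ∀ x ∈ P ∩ φ '' orthant ι, b x = 0) ∨
      ∃ ψ : (ι → ℝ) ≃ₗ[ℝ] V, P ∩ φ '' orthant ι = ψ '' stdSolid ι := by
  have hgen : ∀ i, φ (Pi.single i 1) ∈ φ '' orthant ι := fun i =>
    ⟨_, fun k => by rw [Pi.single_apply]; split_ifs <;> simp, rfl⟩
  by_cases hlow : ∃ b ∈ B, b ≠ 0 ∧ ∀ x ∈ φ '' orthant ι, 0 ≤ b x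
  · obtain ⟨b, hb, hb0, hbC⟩ := hlow
    refine Or.inl ⟨b, hb0, fun x hx => le_antisymm ?_ (hbC x hx.2)⟩
    have := hx.1
    rw [hAB] at this
    exact this.2 b hb
  right
  have hBneg : ∀ b ∈ B, ∀ x ∈ φ '' orthant ι, b x ≤ 0 := by
    intro b hb
    rcases hB b hb with h | h
    · by_cases hb0 : b = 0
      · simp [hb0]
      · exact absurd ⟨b, hb, hb0, h⟩ hlow
    · exact h
  -- the functional that is largest at an interior point of the cone is largest on all of it
  obtain ⟨m, hm, hmax⟩ := A.exists_max_image
    (fun a => a (∑ i, φ (Pi.single i 1))) ⟨0, hA0⟩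
  have hmle : ∀ a ∈ A, ∀ x ∈ φ '' orthant ι, a x ≤ m x := by
    intro a ha x hx
    rcases hA a ha m hm with h | h
    · have h2 : ∀ i, (a - m) (φ (Pi.single i 1)) = 0 := by
        have h3 : ∑ i, (a - m) (φ (Pi.single i 1)) ≤ 0 := by
          have := hmax a ha
          rw [← map_sum, LinearMap.sub_apply]
          linarith
        have h4 := (Finset.sum_eq_zero_iff_of_nonneg fun i _ => h _ (hgen i)).1
          (le_antisymm h3 (Finset.sum_nonneg fun i _ => h _ (hgen i)))
        exact fun i => h4 i (Finset.mem_univ i)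
      have h5 : (a - m) x = 0 := by
        rw [apply_eq_sum_single φ]
        simp [h2]
      rw [LinearMap.sub_apply] at h5
      linarith
    · have := h x hx
      rw [LinearMap.sub_apply] at this
      linarith
  have hmem : ∀ x ∈ φ '' orthant ι, (x ∈ P ↔ m x ≤ 1) := by
    intro x hx
    rw [hAB]
    exact ⟨fun h => h.1 m hm, fun h => ⟨fun a ha => (hmle a ha x hx).trans h,
      fun b hb => hBneg b hb x hx⟩⟩
  -- otherwise the bounded set `P` would contain a ray
  have hmpos : ∀ i, 0 < m (φ (Pi.single i 1)) := by
    intro i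
    by_contra hi
    push Not at hi
    obtain ⟨-, S, hS⟩ := hP
    have hbd : Bornology.IsBounded P := by
      rw [hS, isBounded_convexHull]
      exact S.finite_toSet.isBounded
    obtain ⟨R, hR⟩ := isBounded_iff_forall_norm_le.1 hbd
    have hv : φ (Pi.single i 1) ≠ 0 := by simp
    have hv' : 0 < ‖φ (Pi.single i 1)‖ := norm_pos_iff.2 hv
    have hR0 : 0 ≤ |R| + 1 := by positivity
    have ht : (((|R| + 1) / ‖φ (Pi.single i 1)‖) • φ (Pi.single i 1)) ∈ P := by
      refine (hmem _ ?_).2 ?_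
      · rw [mem_image_orthant]
        intro k
        rw [map_smul, φ.symm_apply_apply, Pi.smul_apply, Pi.single_apply]
        split_ifs
        · simp only [smul_eq_mul, mul_one]
          positivity
        · simp
      · rw [map_smul, smul_eq_mul]
        have := mul_nonpos_of_nonneg_of_nonpos (div_nonneg hR0 hv'.le) hi
        linarith
    have := hR _ ht
    rw [norm_smul, Real.norm_eq_abs, abs_of_nonneg (by positivity), div_mul_cancel₀ _ hv'.ne'] at this
    linarith [le_abs_self R]
  refine ⟨(LinearEquiv.piCongrRight fun i => LinearEquiv.smulOfNeZero ℝ ℝ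
    (m (φ (Pi.single i 1)))⁻¹ (inv_ne_zero (hmpos i).ne')).trans φ, ?_⟩
  ext x
  have hcoord : ∀ i, (((LinearEquiv.piCongrRight fun i => LinearEquiv.smulOfNeZero ℝ ℝ
      (m (φ (Pi.single i 1)))⁻¹ (inv_ne_zero (hmpos i).ne')).trans φ).symm x) i
      = φ.symm x i * m (φ (Pi.single i 1)) := by
    intro i
    have h : ∀ y : ι → ℝ, ((LinearEquiv.piCongrRight fun i => LinearEquiv.smulOfNeZero ℝ ℝ
      (m (φ (Pi.single i 1)))⁻¹ (inv_ne_zero (hmpos i).ne')).trans φ) y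
        = φ fun i => (m (φ (Pi.single i 1)))⁻¹ * y i := fun y => rfl
    have h2 : ((LinearEquiv.piCongrRight fun i => LinearEquiv.smulOfNeZero ℝ ℝ
      (m (φ (Pi.single i 1)))⁻¹ (inv_ne_zero (hmpos i).ne')).trans φ).symm x
        = fun i => φ.symm x i * m (φ (Pi.single i 1)) := by
      rw [LinearEquiv.symm_apply_eq, h]
      conv_lhs => rw [← φ.apply_symm_apply x]
      congr 1
      ext i
      field_simp [(hmpos i).ne']
    rw [h2]
  rw [LinearEquiv.image_eq_preimage_symm (LinearEquiv.trans _ _), Set.mem_inter_iff]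
  simp only [Set.mem_preimage, stdSolid, Set.mem_ofPred_eq, hcoord]
  rw [← apply_eq_sum_single φ m x]
  have hiff : (∀ i, 0 ≤ φ.symm x i * m (φ (Pi.single i 1))) ↔ x ∈ φ '' orthant ι := by
    rw [mem_image_orthant]
    exact forall_congr' fun i => mul_nonneg_iff_of_pos_right (hmpos i)
  rw [hiff]
  exact ⟨fun h => ⟨h.2, (hmem x h.2).1 h.1⟩, fun h => ⟨(hmem x h.1).2 h.2, h.1⟩⟩

/-- A functional on polytopes containing the origin that is additive under cuts by hyperplanes
through the origin, and vanishes on lower-dimensional polytopes and on simplices with a vertex at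
the origin, is zero. -/
theorem eq_zero_of_simplex_eq_zero (e : (ι → ℝ) ≃ₗ[ℝ] V) (μ : Set V → ℝ)
    (hcut : ∀ P, IsPolyO P → ∀ l : Module.Dual ℝ V, l ≠ 0 →
      μ P = μ (P ∩ {x | 0 ≤ l x}) + μ (P ∩ {x | l x ≤ 0}))
    (hlow : ∀ P, IsPolyO P → ∀ l : Module.Dual ℝ V, l ≠ 0 → (∀ x ∈ P, l x = 0) → μ P = 0)
    (hsimplex : ∀ φ : (ι → ℝ) ≃ₗ[ℝ] V, μ (φ '' stdSolid ι) = 0)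
    {P : Set V} (hP : IsPolyO P) : μ P = 0 := by
  classical
  have hfin : FiniteDimensional ℝ V := e.finiteDimensional
  let coord : ((ι → ℝ) ≃ₗ[ℝ] V) → ι → Module.Dual ℝ V := fun φ i =>
    LinearMap.proj i ∘ₗ φ.symm.toLinearMap
  have hcone : ∀ φ : (ι → ℝ) ≃ₗ[ℝ] V, IsPolyO (P ∩ φ '' orthant ι) := by
    intro φ
    convert hP.inter_forall_nonneg Finset.univ (coord φ) using 2
    ext x
    rw [mem_image_orthant]
    simp [coord]
  obtain ⟨A, B, hAB⟩ := hP.exists_halfSpaces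
  have hgood : ∀ φ : (ι → ℝ) ≃ₗ[ℝ] V, μ (P ∩ φ '' orthant ι) = 0 := by
    intro φ
    refine simplicialCone_induction (fun φ => μ (P ∩ φ '' orthant ι) = 0) ?_
      ((((insert 0 A) ×ˢ (insert 0 A)).image fun q => q.1 - q.2) ∪ B).toList φ ?_
    · intro φ i j hij c h0 h1 hg1 hg2
      have h1' : P ∩ φ '' orthant ι ∩ {x | 0 ≤ ((1 - c) • coord φ i - c • coord φ j) x}
          = P ∩ ((edgeEquiv hij h1.ne).trans φ) '' orthant ι := by
        rw [Set.inter_assoc, image_edgeEquiv_trans, image_edgeMap_orthant hij h0.le h1,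
          Set.image_inter φ.injective]
        congr 2
        ext x
        rw [LinearEquiv.image_eq_preimage_symm]
        simp [coord]
      have h2' : P ∩ φ '' orthant ι ∩ {x | ((1 - c) • coord φ i - c • coord φ j) x ≤ 0}
          = P ∩ ((edgeEquiv hij.symm (by linarith : 1 - c ≠ 1)).trans φ) '' orthant ι := by
        rw [Set.inter_assoc, image_edgeEquiv_trans,
          image_edgeMap_orthant hij.symm (by linarith) (by linarith),
          Set.image_inter φ.injective]
        congr 2
        ext x
        rw [LinearEquiv.image_eq_preimage_symm]
        simp [coord]
      have hne : (1 - c) • coord φ i - c • coord φ j ≠ 0 := fun h => by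
        have := LinearMap.congr_fun h (φ (Pi.single i 1))
        simp [coord, hij.symm, sub_eq_zero, h1.ne'] at this
      rw [hcut _ (hcone φ) _ hne, h1', h2', hg1, hg2, add_zero]
    · intro ψ hψ
      have hAB' : P = {x | (∀ a ∈ insert 0 A, a x ≤ 1) ∧ ∀ b ∈ B, b x ≤ 0} := by
        rw [hAB]
        simp
      have hA : ∀ a ∈ insert 0 A, ∀ a' ∈ insert 0 A, ConstSign (a - a') (ψ '' orthant ι) := by
        intro a ha a' ha'
        refine hψ _ ?_
        rw [Finset.mem_toList, Finset.mem_union, Finset.mem_image]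
        exact Or.inl ⟨(a, a'), Finset.mem_product.2 ⟨ha, ha'⟩, rfl⟩
      have hB : ∀ b ∈ B, ConstSign b (ψ '' orthant ι) := by
        intro b hb
        refine hψ _ ?_
        rw [Finset.mem_toList, Finset.mem_union]
        exact Or.inr hb
      rcases hP.inter_simplicialCone hAB' ψ hA (Finset.mem_insert_self _ _) hB with
        ⟨b, hb, hz⟩ | ⟨χ, hχ⟩
      · exact hlow _ (hcone ψ) b hb hz
      · rw [hχ, hsimplex]
  -- cut by the coordinate hyperplanes, one after the other
  have horth : ∀ (s : Finset ι) (ε : ι → ℝˣ),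
      μ (P ∩ {x | ∀ i ∈ Finset.univ \ s, 0 ≤ (((ε i : ℝ)) • coord e i) x}) = 0 := by
    intro s
    induction s using Finset.induction_on with
    | empty =>
      intro ε
      set φ := (LinearEquiv.piCongrRight fun i =>
        (LinearEquiv.smulOfUnit (ε i) : ℝ ≃ₗ[ℝ] ℝ)).trans e with hφ
      refine Eq.trans ?_ (hgood φ)
      congr 2
      ext x
      rw [mem_image_orthant]
      simp only [Finset.sdiff_empty, Finset.mem_univ, true_imp_iff, Set.mem_ofPred_eq, coord,
        LinearMap.smul_apply, LinearMap.comp_apply, LinearMap.proj_apply, LinearEquiv.coe_coe,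
        smul_eq_mul]
      refine forall_congr' fun i => ?_
      have : φ.symm x i = ((ε i : ℝ))⁻¹ * e.symm x i := by
        rw [← Units.val_inv_eq_inv_val]
        rfl
      rw [this]
      have hε : (ε i : ℝ) ≠ 0 := (ε i).ne_zero
      have h2 : (ε i : ℝ) * e.symm x i = (ε i : ℝ) ^ 2 * ((ε i : ℝ)⁻¹ * e.symm x i) := by
        field_simp
      rw [h2]
      exact mul_nonneg_iff_of_pos_left (by positivity)
    | insert a s ha ih =>
      intro ε
      have key : ∀ u : ℝˣ, P ∩ {x | ∀ i ∈ Finset.univ \ insert a s, 0 ≤ (((ε i : ℝ)) • coord e i) x}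
          ∩ {x | 0 ≤ (((u : ℝ)) • coord e a) x} = P ∩ {x | ∀ i ∈ Finset.univ \ s,
            0 ≤ (((Function.update ε a u i : ℝˣ) : ℝ) • coord e i) x} := by
        intro u
        rw [Set.inter_assoc]
        congr 1
        ext x
        simp only [Finset.mem_sdiff, Finset.mem_univ, true_and, Finset.mem_insert, not_or,
          Set.mem_inter_iff, Set.mem_ofPred_eq]
        constructor
        · rintro ⟨h1, h2⟩ i hi
          rcases eq_or_ne i a with rfl | hia
          · simpa using h2
          · rw [Function.update_of_ne hia]
            exact h1 i ⟨hia, hi⟩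
        · intro h
          refine ⟨fun i hi => ?_, by simpa using h a ha⟩
          have := h i hi.2
          rwa [Function.update_of_ne hi.1] at this
      have h1 := key 1
      have h2 := key (-1)
      have h3 : {x | 0 ≤ (((-1 : ℝˣ) : ℝ) • coord e a) x} = {x | coord e a x ≤ 0} := by
        ext x
        simp
      rw [h3] at h2
      simp only [Units.val_one, one_smul] at h1
      have hne : coord e a ≠ 0 := fun h => by
        have := LinearMap.congr_fun h (e (Pi.single a 1))
        simp [coord] at this
      rw [hcut _ (hP.inter_forall_nonneg _ _) _ hne, h1, h2, ih, ih, add_zero]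
  simpa using horth Finset.univ 1

end Vanishing

/-! ### Cones over facets -/

section Cones

variable {n : ℕ}

/-- The cone with apex `0` over the set `F`. -/
def coneSet (F : Set (E n)) : Set (E n) :=
  (fun q : ℝ × E n => q.1 • q.2) '' (Set.Icc 0 1 ×ˢ F)

theorem mem_coneSet {F : Set (E n)} {x : E n} :
    x ∈ coneSet F ↔ ∃ t ∈ Set.Icc (0 : ℝ) 1, ∃ y ∈ F, t • y = x := by
  simp only [coneSet, Set.mem_image, Set.mem_prod, Prod.exists]
  constructor
  · rintro ⟨t, y, ⟨ht, hy⟩, rfl⟩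
    exact ⟨t, ht, y, hy, rfl⟩
  · rintro ⟨t, ht, y, hy, rfl⟩
    exact ⟨t, y, ⟨ht, hy⟩, rfl⟩

theorem isCompact_coneSet {F : Set (E n)} (hF : IsCompact F) : IsCompact (coneSet F) :=
  (isCompact_Icc.prod hF).image (by fun_prop)

theorem image_coneSet (f : E n →ₗ[ℝ] E n) (F : Set (E n)) :
    f '' coneSet F = coneSet (f '' F) := by
  ext x
  simp only [Set.mem_image, mem_coneSet]
  constructor
  · rintro ⟨_, ⟨t, ht, y, hy, rfl⟩, rfl⟩
    exact ⟨t, ht, f y, ⟨y, hy, rfl⟩, by simp⟩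
  · rintro ⟨t, ht, _, ⟨y, hy, rfl⟩, rfl⟩
    exact ⟨t • y, ⟨t, ht, y, hy, rfl⟩, by simp⟩

theorem coneSet_union (F G : Set (E n)) : coneSet (F ∪ G) = coneSet F ∪ coneSet G := by
  rw [coneSet, Set.prod_union, Set.image_union]
  rfl

theorem coneSet_inter {F G : Set (E n)} {a : E n} (hF : ∀ y ∈ F, inner ℝ y a = 1)
    (hG : ∀ y ∈ G, inner ℝ y a = 1) (hne : (F ∩ G).Nonempty) :
    coneSet (F ∩ G) = coneSet F ∩ coneSet G := by
  ext x
  simp only [Set.mem_inter_iff, mem_coneSet]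
  constructor
  · rintro ⟨t, ht, y, ⟨hy1, hy2⟩, rfl⟩
    exact ⟨⟨t, ht, y, hy1, rfl⟩, ⟨t, ht, y, hy2, rfl⟩⟩
  · rintro ⟨⟨t, ht, y, hy, rfl⟩, ⟨s, -, z, hz, h⟩⟩
    have hst : s = t := by
      have := congrArg (fun w => inner ℝ w a) h
      simpa [real_inner_smul_left, hF y hy, hG z hz] using this
    subst hst
    rcases eq_or_ne s 0 with rfl | hs
    · obtain ⟨w, hw⟩ := hne
      exact ⟨0, ht, w, hw, by simp⟩
    · have hzy : z = y := smul_right_injective _ hs h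
      exact ⟨s, ht, y, ⟨hy, hzy ▸ hz⟩, rfl⟩

theorem coneSet_inter_slice (F : Set (E n)) {a : E n} (ha : a ≠ 0) (t : ℝ) :
    coneSet F ∩ (AffineSubspace.mk' (t • ((‖a‖ ^ 2)⁻¹ • a) +ᵥ (0 : E n))
      (ℝ ∙ ((‖a‖ ^ 2)⁻¹ • a))ᗮ : Set (E n)) = coneSet F ∩ {x | inner ℝ x a = t} := by
  have ha2 : ‖a‖ ^ 2 ≠ 0 := pow_ne_zero _ (norm_ne_zero_iff.2 ha)
  congr 1
  ext x
  rw [SetLike.mem_coe, AffineSubspace.mem_mk', Submodule.mem_orthogonal_singleton_iff_inner_left]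
  simp only [vsub_eq_sub, vadd_eq_add, add_zero, Set.mem_ofPred_eq, inner_sub_left,
    real_inner_smul_left, real_inner_smul_right, real_inner_self_eq_norm_sq]
  rw [inv_mul_cancel₀ ha2, mul_one, ← mul_sub, mul_eq_zero, sub_eq_zero]
  simp [ha2]

/-- The volume of a cone over a compact subset of the affine hyperplane `⟨x, a⟩ = 1`, which has
distance `‖a‖⁻¹` from the apex. -/
theorem volume_coneSet (hn : 1 ≤ n) {F : Set (E n)} (hFc : IsCompact F) {a : E n} (ha : a ≠ 0)
    (hF : ∀ y ∈ F, inner ℝ y a = 1) :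
    (n : ℝ) * (volume (coneSet F)).toReal = ‖a‖⁻¹ * (μHE[n - 1] F).toReal := by
  have hn0 : (n : ℝ) ≠ 0 := by positivity
  have hna : 0 < ‖a‖ := norm_pos_iff.2 ha
  have hv : (‖a‖ ^ 2)⁻¹ • a ≠ 0 := smul_ne_zero (inv_ne_zero (by positivity)) ha
  have hfr : Module.finrank ℝ (E n) = n := finrank_euclideanSpace_fin
  have hslice := EuclideanGeometry.euclideanHausdorffMeasure_eq_lintegral (0 : E n) hv
    (isCompact_coneSet hFc).isClosed.measurableSet
  rw [InnerProductSpace.euclideanHausdorffMeasure_eq_volume, hfr] at hslice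
  simp only [coneSet_inter_slice F ha] at hslice
  have hsl : ∀ t : ℝ, t ≠ 0 → μHE[n - 1] (coneSet F ∩ {x | inner ℝ x a = t})
      = (Set.Ioc (0 : ℝ) 1).indicator
        (fun t => ENNReal.ofReal (t ^ (n - 1)) * μHE[n - 1] F) t := by
    intro t ht
    by_cases htI : t ∈ Set.Ioc (0 : ℝ) 1
    · rw [Set.indicator_of_mem htI]
      have : coneSet F ∩ {x | inner ℝ x a = t} = t • F := by
        ext x
        rw [Set.mem_smul_set]
        simp only [Set.mem_inter_iff, mem_coneSet, Set.mem_ofPred_eq]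
        constructor
        · rintro ⟨⟨s, -, y, hy, rfl⟩, h⟩
          rw [real_inner_smul_left, hF y hy, mul_one] at h
          exact ⟨y, hy, by rw [h]⟩
        · rintro ⟨y, hy, rfl⟩
          exact ⟨⟨t, ⟨htI.1.le, htI.2⟩, y, hy, rfl⟩, by
            rw [real_inner_smul_left, hF y hy, mul_one]⟩
      rw [this, Measure.euclideanHausdorffMeasure_smul₀ _ ht, ENNReal.smul_def, smul_eq_mul]
      congr 1
      rw [ENNReal.coe_pow, ENNReal.ofReal_pow htI.1.le]
      congr 1
      rw [← enorm_eq_nnnorm, Real.enorm_eq_ofReal htI.1.le]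
    · rw [Set.indicator_of_notMem htI]
      have : coneSet F ∩ {x | inner ℝ x a = t} = ∅ := by
        ext x
        simp only [Set.mem_inter_iff, mem_coneSet, Set.mem_ofPred_eq, Set.mem_empty_iff_false,
          iff_false, not_and]
        rintro ⟨s, hs, y, hy, rfl⟩ h
        rw [real_inner_smul_left, hF y hy, mul_one] at h
        subst h
        exact htI ⟨lt_of_le_of_ne hs.1 ht.symm, hs.2⟩
      rw [this, measure_empty]
  have hae : (fun t : ℝ => μHE[n - 1] (coneSet F ∩ {x | inner ℝ x a = t})) =ᵐ[volume]
      (Set.Ioc (0 : ℝ) 1).indicator (fun t => ENNReal.ofReal (t ^ (n - 1)) * μHE[n - 1] F) := by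
    have : ∀ᵐ t : ℝ, t ≠ 0 := by simp [ae_iff]
    filter_upwards [this] with t ht
    exact hsl t ht
  have hint : ∫⁻ t in Set.Ioc (0 : ℝ) 1, ENNReal.ofReal (t ^ (n - 1))
      = ENNReal.ofReal ((n : ℝ)⁻¹) := by
    rw [← ofReal_integral_eq_lintegral_ofReal]
    · rw [← intervalIntegral.integral_of_le zero_le_one, integral_pow]
      congr 1
      rw [Nat.cast_sub hn, Nat.sub_add_cancel hn, one_pow, zero_pow (by omega)]
      simp
    · exact ((continuous_pow (n - 1)).integrableOn_Icc).mono_set Set.Ioc_subset_Icc_self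
    · filter_upwards [ae_restrict_mem measurableSet_Ioc] with t ht
      exact pow_nonneg ht.1.le _
  rw [lintegral_congr_ae hae, lintegral_indicator measurableSet_Ioc,
    lintegral_mul_const _ (by fun_prop), hint] at hslice
  rw [hslice]
  simp only [ENNReal.toReal_mul, toReal_enorm, norm_smul, norm_inv, norm_pow, norm_norm]
  rw [ENNReal.toReal_ofReal (by positivity)]
  field_simp

end Cones

/-! ### Faces and support functions -/

section Faces

variable {n : ℕ}

theorem supp_eq_of {K : ConvexBody (E n)} {u : E n} {r : ℝ} (h : ∀ x ∈ K, inner ℝ x u ≤ r)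
    (h' : ∃ x ∈ K, inner ℝ x u = r) : supp K u = r := by
  obtain ⟨x, hx, hxr⟩ := h'
  obtain ⟨y, hy, hyr⟩ := exists_inner_eq_supp K u
  exact le_antisymm (hyr ▸ h y hy) (hxr ▸ inner_le_supp K u hx)

theorem supp_smul (K : ConvexBody (E n)) {c : ℝ} (hc : 0 ≤ c) (u : E n) :
    supp K (c • u) = c * supp K u := by
  obtain ⟨y, hy, hyr⟩ := exists_inner_eq_supp K u
  refine supp_eq_of (fun x hx => ?_) ⟨y, hy, ?_⟩
  · rw [real_inner_smul_right]
    exact mul_le_mul_of_nonneg_left (inner_le_supp K u hx) hc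
  · rw [real_inner_smul_right, hyr]

theorem face_smul (K : ConvexBody (E n)) {c : ℝ} (hc : 0 < c) (u : E n) :
    face K (c • u) = face K u := by
  ext x
  simp only [face, Set.mem_inter_iff, Set.mem_ofPred_eq, supp_smul K hc.le,
    real_inner_smul_right, mul_right_inj' hc.ne']

theorem isCompact_face (K : ConvexBody (E n)) (u : E n) : IsCompact (face K u) :=
  K.isCompact.inter_right (isClosed_eq (by fun_prop) continuous_const)

theorem face_nonempty (K : ConvexBody (E n)) (u : E n) : (face K u).Nonempty := by
  obtain ⟨x, hx, h⟩ := exists_inner_eq_supp K u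
  exact ⟨x, hx, h⟩

theorem supp_image (f : E n →ₗ[ℝ] E n) {K L : ConvexBody (E n)}
    (h : (L : Set (E n)) = f '' K) (u : E n) : supp L u = supp K (LinearMap.adjoint f u) := by
  obtain ⟨y, hy, hyr⟩ := exists_inner_eq_supp K (LinearMap.adjoint f u)
  refine supp_eq_of (fun x hx => ?_) ⟨f y, ?_, ?_⟩
  · have hx : x ∈ (L : Set (E n)) := hx
    rw [h] at hx
    obtain ⟨z, hz, rfl⟩ := hx
    rw [← LinearMap.adjoint_inner_right]
    exact inner_le_supp K _ hz
  · have : f y ∈ (L : Set (E n)) := h ▸ ⟨y, hy, rfl⟩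
    exact this
  · rw [← LinearMap.adjoint_inner_right, hyr]

theorem face_image (f : E n →ₗ[ℝ] E n) {K L : ConvexBody (E n)}
    (h : (L : Set (E n)) = f '' K) (u : E n) :
    face L u = f '' face K (LinearMap.adjoint f u) := by
  ext x
  simp only [face, Set.mem_inter_iff, Set.mem_image, Set.mem_ofPred_eq, supp_image f h, h]
  constructor
  · rintro ⟨⟨y, hy, rfl⟩, hx⟩
    exact ⟨y, ⟨hy, by rw [LinearMap.adjoint_inner_right, hx]⟩, rfl⟩
  · rintro ⟨y, ⟨hy, hx⟩, rfl⟩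
    exact ⟨⟨y, hy, rfl⟩, by rw [← LinearMap.adjoint_inner_right, hx]⟩

/-- The volume of the cone with apex `0` over the face of `K` in direction `a`. -/
noncomputable def coneVol (K : ConvexBody (E n)) (a : E n) : ℝ :=
  (volume (coneSet (face K a))).toReal

theorem inner_eq_one_of_mem_face {K : ConvexBody (E n)} {a : E n} (ha : supp K a = 1) :
    ∀ y ∈ face K a, inner ℝ y a = 1 := fun y hy => by
  have : inner ℝ y a = supp K a := hy.2
  rw [this, ha]

theorem ne_zero_of_supp_eq_one {K : ConvexBody (E n)} {a : E n} (ha : supp K a = 1) : a ≠ 0 := by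
  rintro rfl
  have h := supp_smul K le_rfl (0 : E n)
  rw [smul_zero, zero_mul] at h
  linarith

theorem coneVol_eq_zero_of_subset {K : ConvexBody (E n)} {a : E n} {p : Submodule ℝ (E n)}
    (hp : p ≠ ⊤) (h : face K a ⊆ p) : coneVol K a = 0 := by
  have : coneSet (face K a) ⊆ p := by
    intro x hx
    obtain ⟨t, -, y, hy, rfl⟩ := mem_coneSet.1 hx
    exact p.smul_mem t (h hy)
  rw [coneVol, measure_mono_null this (Measure.addHaar_submodule volume p hp)]
  rfl

/-- If the cone over `F(K, a)` has positive volume, then `F(K, a)` is a facet. -/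
theorem finrank_face_of_coneVol_ne_zero {K : ConvexBody (E n)} {a : E n} (ha : supp K a = 1)
    (h : coneVol K a ≠ 0) : Module.finrank ℝ (vectorSpan ℝ (face K a)) + 1 = n := by
  have hspan : Submodule.span ℝ (face K a) = ⊤ := by
    by_contra hne
    exact h (coneVol_eq_zero_of_subset hne Submodule.subset_span)
  obtain ⟨y, hy⟩ := face_nonempty K a
  have h1 : Submodule.span ℝ (face K a) ≤ vectorSpan ℝ (face K a) ⊔ Submodule.span ℝ {y} := by
    rw [Submodule.span_le]
    intro x hx
    have h2 : x - y ∈ vectorSpan ℝ (face K a) := vsub_mem_vectorSpan ℝ hx hy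
    have := Submodule.add_mem_sup h2 (Submodule.mem_span_singleton_self (R := ℝ) y)
    rwa [sub_add_cancel] at this
  have h3 := Submodule.finrank_mono h1
  have h4 := Submodule.finrank_add_le_finrank_add_finrank (vectorSpan ℝ (face K a))
    (Submodule.span ℝ {y})
  have h5 := finrank_span_le_card (R := ℝ) ({y} : Set (E n))
  rw [hspan, finrank_top, finrank_euclideanSpace_fin] at h3
  rw [Set.toFinset_singleton, Finset.card_singleton] at h5
  have h6 : vectorSpan ℝ (face K a) ≤ LinearMap.ker (innerₛₗ ℝ a) := by
    rw [vectorSpan_def, Submodule.span_le]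
    rintro _ ⟨x, hx, z, hz, rfl⟩
    simp only [vsub_eq_sub, SetLike.mem_coe, LinearMap.mem_ker, innerₛₗ_apply_apply,
      inner_sub_right]
    rw [real_inner_comm, real_inner_comm z, inner_eq_one_of_mem_face ha x hx,
      inner_eq_one_of_mem_face ha z hz, sub_self]
  have h7 : vectorSpan ℝ (face K a) < ⊤ := by
    refine lt_of_le_of_ne le_top fun h8 => ?_
    rw [h8, top_le_iff] at h6
    have : a ∈ LinearMap.ker (innerₛₗ ℝ a) := h6 ▸ Submodule.mem_top
    rw [LinearMap.mem_ker, innerₛₗ_apply_apply, inner_self_eq_zero] at this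
    exact ne_zero_of_supp_eq_one ha this
  have h8 := Submodule.finrank_lt_finrank_of_lt h7
  rw [finrank_top, finrank_euclideanSpace_fin] at h8
  omega

end Faces

/-! ### Sums over facets as sums of cone volumes -/

section ConeSums

variable {n : ℕ}

/-- The sum of `vol(cone over F(K, a)) g(a)` over all `a` with `h(K, a) = 1`. The facets of a
polytope that miss the origin are those `F(K, a)` for which the volume is positive. -/
noncomputable def coneSum (K : ConvexBody (E n)) (g : E n → ℝ) : ℝ :=
  ∑ᶠ a ∈ {a | supp K a = 1}, coneVol K a * g a

theorem supp_pos_of_zero_notMem_face {P : PolytopeO n} {v : E n}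
    (hv : (0 : E n) ∉ face P.1 v) : 0 < supp P.1 v := by
  refine lt_of_le_of_ne (supp_nonneg ⟨P.1, P.2.2⟩ v) fun h => hv ⟨P.2.2, ?_⟩
  simpa using h

theorem mem_normalizedNormals {P : PolytopeO n} {a : E n} (ha : supp P.1 a = 1)
    (h : coneVol P.1 a ≠ 0) : a ∈ (fun v => (supp P.1 v)⁻¹ • v) ''
      {v ∈ facetNormals P.1 | (0 : E n) ∉ face P.1 v} := by
  have hna : 0 < ‖a‖ := norm_pos_iff.2 (ne_zero_of_supp_eq_one ha)
  have hface := face_smul P.1 (inv_pos.2 hna) a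
  refine ⟨‖a‖⁻¹ • a, ⟨⟨?_, ?_⟩, ?_⟩, ?_⟩
  · rw [norm_smul, norm_inv, norm_norm, inv_mul_cancel₀ hna.ne']
  · rw [hface]
    exact finrank_face_of_coneVol_ne_zero ha h
  · rw [hface]
    intro h0
    simpa using inner_eq_one_of_mem_face ha 0 h0
  · simp only [supp_smul P.1 (inv_pos.2 hna).le, ha, mul_one, inv_inv, smul_smul]
    rw [mul_inv_cancel₀ hna.ne', one_smul]

theorem finite_coneVol_ne_zero (P : PolytopeO n) :
    {a | supp P.1 a = 1 ∧ coneVol P.1 a ≠ 0}.Finite :=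
  (((facetNormals_finite P.2.1).subset fun _ hv => hv.1).image _).subset
    fun _ ha => mem_normalizedNormals ha.1 ha.2

/-- The facet with unit normal `v` is `F(P, a)` for `a = v / h(P, v)`, and the cone over it has
height `h(P, v)`. Homogeneity of `g` absorbs the factor `h(P, v) ^ (-p)`. -/
theorem facetSum_eq_coneSum (hn : 1 ≤ n) (p : ℝ) (P : PolytopeO n) (g : E n → ℝ)
    (hg : ∀ c : ℝ, 0 < c → ∀ v, g (c • v) = c ^ p * g v) :
    facetSum p P g = n * coneSum P.1 g := by
  set N := {v ∈ facetNormals P.1 | (0 : E n) ∉ face P.1 v} with hN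
  have hpos : ∀ v ∈ N, 0 < supp P.1 v := fun v hv => supp_pos_of_zero_notMem_face hv.2
  have hone : ∀ v ∈ N, supp P.1 ((supp P.1 v)⁻¹ • v) = 1 := fun v hv => by
    rw [supp_smul P.1 (inv_pos.2 (hpos v hv)).le, inv_mul_cancel₀ (hpos v hv).ne']
  have hinj : Set.InjOn (fun v => (supp P.1 v)⁻¹ • v) N := by
    intro v hv w hw h
    have h1 : ‖v‖ = 1 := hv.1.1
    have h2 : ‖w‖ = 1 := hw.1.1
    have h3 : (supp P.1 v)⁻¹ = (supp P.1 w)⁻¹ := by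
      have := congrArg norm h
      simpa [norm_smul, h1, h2, abs_of_pos (hpos v hv), abs_of_pos (hpos w hw)] using this
    simp only at h
    rw [h3] at h
    exact smul_right_injective _ (inv_ne_zero (hpos w hw).ne') h
  have hterm : ∀ v ∈ N, (μHE[n - 1] (face P.1 v)).toReal * supp P.1 v ^ (1 - p) * g v
      = n * (coneVol P.1 ((supp P.1 v)⁻¹ • v) * g ((supp P.1 v)⁻¹ • v)) := by
    intro v hv
    have hh := hpos v hv
    have hface := face_smul P.1 (inv_pos.2 hh) v
    have := volume_coneSet hn (isCompact_face P.1 ((supp P.1 v)⁻¹ • v))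
      (ne_zero_of_supp_eq_one (hone v hv)) (inner_eq_one_of_mem_face (hone v hv))
    have hnorm : ‖(supp P.1 v)⁻¹ • v‖ = (supp P.1 v)⁻¹ := by
      rw [norm_smul, hv.1.1, mul_one, Real.norm_of_nonneg (inv_pos.2 hh).le]
    rw [hnorm, inv_inv, hface] at this
    rw [← mul_assoc, coneVol, hface, this, hg _ (inv_pos.2 hh), Real.rpow_sub hh, Real.rpow_one,
      Real.inv_rpow hh.le]
    ring
  have h1 : coneSum P.1 g
      = ∑ᶠ a ∈ (fun v => (supp P.1 v)⁻¹ • v) '' N, coneVol P.1 a * g a := by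
    refine finsum_mem_inter_support_eq _ _ _ (Set.Subset.antisymm ?_ ?_)
    · rintro a ⟨ha, hs⟩
      exact ⟨mem_normalizedNormals ha (left_ne_zero_of_mul hs), hs⟩
    · rintro _ ⟨⟨v, hv, rfl⟩, hs⟩
      exact ⟨hone v hv, hs⟩
  rw [h1, mul_finsum_mem, finsum_mem_image hinj]
  exact finsum_mem_congr rfl hterm

theorem coneSum_eq_finsum (K : ConvexBody (E n)) (g : E n → ℝ) :
    coneSum K g = ∑ᶠ a, Set.indicator {a | supp K a = 1} (fun a => coneVol K a * g a) a :=
  finsum_mem_def _ _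

/-- The contributions of two bodies with convex union satisfy the valuation identity, direction by
direction. -/
theorem indicator_coneVol_valuation {P Q U I : ConvexBody (E n)}
    (hU : (U : Set (E n)) = (P : Set (E n)) ∪ Q) (hI : (I : Set (E n)) = (P : Set (E n)) ∩ Q)
    (a : E n) :
    Set.indicator {a | supp U a = 1} (coneVol U) a + Set.indicator {a | supp I a = 1} (coneVol I) a
      = Set.indicator {a | supp P a = 1} (coneVol P) a
        + Set.indicator {a | supp Q a = 1} (coneVol Q) a := by
  have memU : ∀ {x}, x ∈ U ↔ x ∈ P ∨ x ∈ Q := fun {x} => by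
    rw [← SetLike.mem_coe, hU]
    rfl
  have memI : ∀ {x}, x ∈ I ↔ x ∈ P ∧ x ∈ Q := fun {x} => by
    rw [← SetLike.mem_coe, hI]
    rfl
  -- If `h(Q, a) < h(P, a)`, a segment from `F(P, a)` to `F(Q, a)` shows that `F(Q, a) ⊆ P`.
  have hlt : ∀ {P Q : ConvexBody (E n)}, (∀ {x}, x ∈ U ↔ x ∈ P ∨ x ∈ Q) →
      (∀ {x}, x ∈ I ↔ x ∈ P ∧ x ∈ Q) → supp Q a < supp P a →
      supp U a = supp P a ∧ face U a = face P a ∧ supp I a = supp Q a ∧ face I a = face Q a := by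
    intro P Q memU memI h
    have hsU : supp U a = supp P a := by
      obtain ⟨x, hx, hxa⟩ := exists_inner_eq_supp P a
      refine supp_eq_of (fun y hy => ?_) ⟨x, memU.2 (Or.inl hx), hxa⟩
      rcases memU.1 hy with hy | hy
      · exact inner_le_supp P a hy
      · exact (inner_le_supp Q a hy).trans h.le
    have hQP : ∀ y ∈ Q, inner ℝ y a = supp Q a → y ∈ P := by
      intro y hy hya
      obtain ⟨x, hx, hxa⟩ := exists_inner_eq_supp P a
      have hcl : y ∈ closure (P : Set (E n)) := by
        have htend : Filter.Tendsto (fun t : ℝ => AffineMap.lineMap y x t)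
            (nhdsWithin 0 (Set.Ioi 0)) (nhds y) := by
          have : Filter.Tendsto (fun t : ℝ => AffineMap.lineMap y x t) (nhds 0)
              (nhds (AffineMap.lineMap y x (0 : ℝ))) :=
            (AffineMap.lineMap_continuous).tendsto 0
          rw [AffineMap.lineMap_apply_zero] at this
          exact this.mono_left nhdsWithin_le_nhds
        refine mem_closure_of_tendsto htend ?_
        filter_upwards [Ioc_mem_nhdsGT (zero_lt_one (α := ℝ))] with t ht
        have hU' : AffineMap.lineMap y x t ∈ U :=
          U.convex.lineMap_mem (memU.2 (Or.inr hy)) (memU.2 (Or.inl hx)) ⟨ht.1.le, ht.2⟩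
        rcases memU.1 hU' with hP | hQ
        · exact hP
        · exfalso
          have := inner_le_supp Q a hQ
          rw [AffineMap.lineMap_apply_module, inner_add_left, real_inner_smul_left,
            real_inner_smul_left, hya, hxa] at this
          nlinarith [ht.1]
      rwa [P.isClosed.closure_eq] at hcl
    have hsI : supp I a = supp Q a := by
      obtain ⟨y, hy, hya⟩ := exists_inner_eq_supp Q a
      exact supp_eq_of (fun z hz => inner_le_supp Q a (memI.1 hz).2)
        ⟨y, memI.2 ⟨hQP y hy hya, hy⟩, hya⟩
    refine ⟨hsU, ?_, hsI, ?_⟩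
    · ext x
      simp only [face, Set.mem_inter_iff, SetLike.mem_coe, Set.mem_ofPred_eq, hsU, memU]
      refine ⟨fun hx => ⟨hx.1.resolve_right fun hQ => ?_, hx.2⟩, fun hx => ⟨Or.inl hx.1, hx.2⟩⟩
      have := inner_le_supp Q a hQ
      linarith [hx.2]
    · ext x
      simp only [face, Set.mem_inter_iff, SetLike.mem_coe, Set.mem_ofPred_eq, hsI, memI]
      exact ⟨fun hx => ⟨hx.1.2, hx.2⟩, fun hx => ⟨⟨hQP x hx.1 hx.2, hx.1⟩, hx.2⟩⟩
  simp only [Set.indicator_apply, Set.mem_ofPred_eq]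
  rcases lt_trichotomy (supp Q a) (supp P a) with h | h | h
  · obtain ⟨h1, h2, h3, h4⟩ := hlt memU memI h
    simp only [h1, h3, coneVol, h2, h4]
  · -- here `F(U, a)` is a convex union of two closed sets, which therefore intersect
    have hsU : supp U a = supp P a := by
      obtain ⟨x, hx, hxa⟩ := exists_inner_eq_supp P a
      refine supp_eq_of (fun y hy => ?_) ⟨x, memU.2 (Or.inl hx), hxa⟩
      rcases memU.1 hy with hy | hy
      · exact inner_le_supp P a hy
      · exact (inner_le_supp Q a hy).trans h.le
    have hfU : face U a = face P a ∪ face Q a := by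
      ext x
      simp only [face, Set.mem_inter_iff, SetLike.mem_coe, Set.mem_ofPred_eq, hsU, h, memU,
        Set.mem_union]
      tauto
    obtain ⟨z, hzP, hzQ⟩ : ∃ z, z ∈ face P a ∧ z ∈ face Q a := by
      obtain ⟨x, hx⟩ := face_nonempty P a
      obtain ⟨y, hy⟩ := face_nonempty Q a
      have hconv : Convex ℝ (face U a) :=
        U.convex.inter (convex_hyperplane (IsLinearMap.mk (fun x y => inner_add_left x y a)
          fun c x => real_inner_smul_left x a c) _)
      obtain ⟨z, -, hz⟩ := isPreconnected_closed_iff.1 hconv.isPreconnected _ _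
        (isCompact_face P a).isClosed (isCompact_face Q a).isClosed hfU.subset
        ⟨x, hfU ▸ Or.inl hx, hx⟩ ⟨y, hfU ▸ Or.inr hy, hy⟩
      exact ⟨z, hz⟩
    have hsI : supp I a = supp P a :=
      supp_eq_of (fun y hy => inner_le_supp P a (memI.1 hy).1) ⟨z, memI.2 ⟨hzP.1, hzQ.1⟩, hzP.2⟩
    have hfI : face I a = face P a ∩ face Q a := by
      ext x
      simp only [face, Set.mem_inter_iff, SetLike.mem_coe, Set.mem_ofPred_eq, hsI, h, memI]
      tauto
    simp only [hsU, hsI, h]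
    split_ifs with h1
    · have hcone : coneSet (face I a) = coneSet (face P a) ∩ coneSet (face Q a) := by
        rw [hfI]
        exact coneSet_inter (inner_eq_one_of_mem_face h1)
          (inner_eq_one_of_mem_face (h.trans h1)) ⟨z, hzP, hzQ⟩
      have hP := isCompact_coneSet (isCompact_face P a)
      have hQ := isCompact_coneSet (isCompact_face Q a)
      simp only [coneVol]
      rw [hcone, hfU, coneSet_union, ← ENNReal.toReal_add, ← ENNReal.toReal_add,
        measure_union_add_inter _ hQ.isClosed.measurableSet]
      · exact hP.measure_lt_top.ne
      · exact hQ.measure_lt_top.ne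
      · exact (hP.union hQ).measure_lt_top.ne
      · exact (measure_mono_top Set.inter_subset_left).mt hP.measure_lt_top.ne
    · rfl
  · obtain ⟨h1, h2, h3, h4⟩ := hlt (fun {x} => memU.trans or_comm) (fun {x} => memI.trans and_comm) h
    simp only [h1, h3, coneVol, h2, h4]
    exact add_comm _ _

theorem coneSum_valuation {P Q U I : PolytopeO n}
    (hU : (U.1 : Set (E n)) = (P.1 : Set (E n)) ∪ (Q.1 : Set (E n)))
    (hI : (I.1 : Set (E n)) = (P.1 : Set (E n)) ∩ (Q.1 : Set (E n))) (g : E n → ℝ) :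
    coneSum U.1 g + coneSum I.1 g = coneSum P.1 g + coneSum Q.1 g := by
  have hfin : ∀ K : PolytopeO n, (Function.support
      (Set.indicator {a | supp K.1 a = 1} (fun a => coneVol K.1 a * g a))).Finite := fun K =>
    (finite_coneVol_ne_zero K).subset fun a ha => by
      rw [Set.support_indicator] at ha
      exact ⟨ha.1, left_ne_zero_of_mul ha.2⟩
  simp only [coneSum_eq_finsum]
  rw [← finsum_add_distrib (hfin U) (hfin I), ← finsum_add_distrib (hfin P) (hfin Q)]
  refine finsum_congr fun a => ?_
  have := indicator_coneVol_valuation hU hI a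
  simp only [Set.indicator_mul_left, ← add_mul, this]

theorem coneSum_image (f : E n ≃ₗ[ℝ] E n) {K L : ConvexBody (E n)}
    (h : (L : Set (E n)) = f '' K) (g : E n → ℝ) :
    coneSum L g = |LinearMap.det (f : E n →ₗ[ℝ] E n)|
      * coneSum K fun b => g (LinearMap.adjoint (f.symm : E n →ₗ[ℝ] E n) b) := by
  have h' : (L : Set (E n)) = (f : E n →ₗ[ℝ] E n) '' K := h
  have hadj : ∀ b, LinearMap.adjoint (f : E n →ₗ[ℝ] E n)
      (LinearMap.adjoint (f.symm : E n →ₗ[ℝ] E n) b) = b := by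
    intro b
    rw [← LinearMap.comp_apply, ← LinearMap.adjoint_comp]
    simp
  have hadj' : ∀ b, LinearMap.adjoint (f.symm : E n →ₗ[ℝ] E n)
      (LinearMap.adjoint (f : E n →ₗ[ℝ] E n) b) = b := by
    intro b
    rw [← LinearMap.comp_apply, ← LinearMap.adjoint_comp]
    simp
  have hvol : ∀ a, coneVol L a = |LinearMap.det (f : E n →ₗ[ℝ] E n)|
      * coneVol K (LinearMap.adjoint (f : E n →ₗ[ℝ] E n) a) := by
    intro a
    rw [coneVol, face_image _ h', ← image_coneSet, Measure.addHaar_image_linearMap,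
      ENNReal.toReal_mul, ENNReal.toReal_ofReal (abs_nonneg _)]
    rfl
  rw [coneSum, coneSum]
  rw [mul_finsum_mem]
  refine finsum_mem_eq_of_bijOn (LinearMap.adjoint (f : E n →ₗ[ℝ] E n)) ⟨?_, ?_, ?_⟩ ?_
  · intro a ha
    rw [Set.mem_ofPred_eq, supp_image _ h'] at ha
    exact ha
  · exact (Function.LeftInverse.injective hadj').injOn
  · intro b hb
    refine ⟨LinearMap.adjoint (f.symm : E n →ₗ[ℝ] E n) b, ?_, hadj b⟩
    rw [Set.mem_ofPred_eq, supp_image _ h', hadj]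
    exact hb
  · intro a _
    rw [hvol, hadj']
    ring

theorem coneSum_eq_zero_of_subset {K : ConvexBody (E n)} {q : Submodule ℝ (E n)} (hq : q ≠ ⊤)
    (h : (K : Set (E n)) ⊆ q) (g : E n → ℝ) : coneSum K g = 0 := by
  rw [coneSum]
  refine finsum_mem_eq_zero_of_forall_eq_zero fun a _ => ?_
  rw [coneVol_eq_zero_of_subset hq (Set.inter_subset_left.trans h), zero_mul]

/-- A simplex with a vertex at the origin has a single facet that misses the origin. -/
theorem coneSum_simplex (hn : 1 ≤ n) (φ : (Fin n → ℝ) ≃ₗ[ℝ] E n) {K : ConvexBody (E n)}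
    (hK : (K : Set (E n)) = φ '' stdSolid (Fin n)) {a : E n}
    (ha : ∀ y, inner ℝ (φ y) a = ∑ i, y i) (g : E n → ℝ) :
    coneSum K g = (volume (φ '' stdSolid (Fin n))).toReal * g a := by
  have memK : ∀ {y}, φ y ∈ K ↔ y ∈ stdSolid (Fin n) := fun {y} => by
    rw [← SetLike.mem_coe, hK, φ.injective.mem_set_image]
  have hsing : ∀ i, (Pi.single i 1 : Fin n → ℝ) ∈ stdSolid (Fin n) := fun i =>
    ⟨fun k => by rw [Pi.single_apply]; split_ifs <;> simp, by simp⟩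
  have hsupp : supp K a = 1 := by
    refine supp_eq_of (fun x hx => ?_) ⟨φ (Pi.single ⟨0, hn⟩ 1), memK.2 (hsing _), by simp [ha]⟩
    obtain ⟨y, rfl⟩ := φ.surjective x
    rw [ha]
    exact (memK.1 hx).2
  have huniq : ∀ b, supp K b = 1 → coneVol K b ≠ 0 → b = a := by
    intro b hb hvol
    have hle : ∀ i, inner ℝ (φ (Pi.single i 1)) b ≤ 1 := fun i =>
      (inner_le_supp K b (memK.2 (hsing i))).trans_eq hb
    have hinner : ∀ y : Fin n → ℝ,
        inner ℝ (φ y) b = ∑ i, y i * inner ℝ (φ (Pi.single i 1)) b := by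
      intro y
      have := apply_eq_sum_single φ (innerₛₗ ℝ b) (φ y)
      simpa [real_inner_comm] using this
    have heq : ∀ i, inner ℝ (φ (Pi.single i 1)) b = 1 := by
      intro i
      by_contra hne
      have hlt := lt_of_le_of_ne (hle i) hne
      -- the face lies in the facet opposite to the vertex with index `i`
      refine hvol (coneVol_eq_zero_of_subset (p := LinearMap.ker
        (LinearMap.proj i ∘ₗ (φ.symm : E n →ₗ[ℝ] (Fin n → ℝ)))) ?_ ?_)
      · intro htop
        have : φ (Pi.single i 1) ∈ LinearMap.ker
          (LinearMap.proj i ∘ₗ (φ.symm : E n →ₗ[ℝ] (Fin n → ℝ))) := htop ▸ Submodule.mem_top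
        simp at this
      · intro x hx
        obtain ⟨y, rfl⟩ := φ.surjective x
        have hy := memK.1 hx.1
        have h1 := inner_eq_one_of_mem_face hb _ hx
        rw [hinner] at h1
        have h2 : ∑ k, y k * (1 - inner ℝ (φ (Pi.single k 1)) b) ≤ 0 := by
          simp only [mul_sub, mul_one, Finset.sum_sub_distrib, h1]
          linarith [hy.2]
        have h3 := (Finset.sum_eq_zero_iff_of_nonneg fun k _ =>
          mul_nonneg (hy.1 k) (sub_nonneg.2 (hle k))).1 (le_antisymm h2
            (Finset.sum_nonneg fun k _ => mul_nonneg (hy.1 k) (sub_nonneg.2 (hle k)))) i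
              (Finset.mem_univ i)
        have h4 : y i = 0 := by
          rcases mul_eq_zero.1 h3 with h | h
          · exact h
          · linarith
        simpa using h4
    refine ext_inner_left ℝ fun x => ?_
    obtain ⟨y, rfl⟩ := φ.surjective x
    rw [hinner, ha]
    simp [heq]
  have hcone : coneSet (face K a) = K := by
    ext x
    obtain ⟨y, rfl⟩ := φ.surjective x
    rw [mem_coneSet, SetLike.mem_coe, memK]
    constructor
    · rintro ⟨t, ht, z, hz, h⟩
      obtain ⟨w, rfl⟩ := φ.surjective z
      have hw := memK.1 hz.1
      rw [← map_smul] at h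
      have h := φ.injective h
      subst h
      refine ⟨fun i => mul_nonneg ht.1 (hw.1 i), ?_⟩
      simp only [Pi.smul_apply, smul_eq_mul, ← Finset.mul_sum]
      nlinarith [hw.2, ht.1, ht.2]
    · intro hy
      have hs0 : 0 ≤ ∑ i, y i := Finset.sum_nonneg fun i _ => hy.1 i
      rcases hs0.eq_or_lt with hs | hs
      · obtain ⟨z, hz⟩ := face_nonempty K a
        have h0 := (Finset.sum_eq_zero_iff_of_nonneg fun i _ => hy.1 i).1 hs.symm
        have : y = 0 := funext fun i => h0 i (Finset.mem_univ i)
        exact ⟨0, by simp, z, hz, by simp [this]⟩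
      · refine ⟨∑ i, y i, ⟨hs0, hy.2⟩, φ ((∑ i, y i)⁻¹ • y), ⟨memK.2 ⟨fun i => ?_, ?_⟩, ?_⟩, ?_⟩
        · exact mul_nonneg (inv_nonneg.2 hs0) (hy.1 i)
        · simp only [Pi.smul_apply, smul_eq_mul, ← Finset.mul_sum]
          rw [inv_mul_cancel₀ hs.ne']
        · rw [Set.mem_ofPred_eq, ha, hsupp]
          simp only [Pi.smul_apply, smul_eq_mul, ← Finset.mul_sum]
          rw [inv_mul_cancel₀ hs.ne']
        · rw [map_smul, smul_smul, mul_inv_cancel₀ hs.ne', one_smul]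
  have hsum : coneSum K g = ∑ᶠ b ∈ ({a} : Set (E n)), coneVol K b * g b := by
    refine finsum_mem_inter_support_eq _ _ _ (Set.Subset.antisymm ?_ ?_)
    · rintro b ⟨hb, hs⟩
      exact ⟨huniq b hb (left_ne_zero_of_mul hs), hs⟩
    · rintro _ ⟨rfl, hs⟩
      exact ⟨hsupp, hs⟩
  rw [hsum, finsum_mem_singleton, coneVol, hcone, hK]

theorem volume_stdSolid_pos : 0 < (volume (stdSolid (Fin n))).toReal := by
  refine ENNReal.toReal_pos (ne_of_gt ?_) ?_
  · have hopen : IsOpen {y : Fin n → ℝ | (∀ i, 0 < y i) ∧ ∑ i, y i < 1} := by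
      rw [Set.ofPred_and, Set.ofPred_forall]
      exact (isOpen_iInter_of_finite fun i => isOpen_lt continuous_const (continuous_apply i)).inter
        (isOpen_lt (by fun_prop) continuous_const)
    refine (hopen.measure_pos volume ⟨fun _ => ((n : ℝ) + 1)⁻¹, fun i => by positivity, ?_⟩).trans_le
      (measure_mono fun y hy => ⟨fun i => (hy.1 i).le, hy.2.le⟩)
    simp only [Finset.sum_const, Finset.card_univ, Fintype.card_fin, nsmul_eq_mul]
    rw [← div_eq_mul_inv, div_lt_one (by positivity)]
    linarith
  · obtain ⟨-, S, hS⟩ := isPolyO_stdSolid (ι := Fin n)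
    rw [hS]
    exact (isBounded_convexHull.2 S.finite_toSet.isBounded).measure_lt_top.ne

end ConeSums

/-! ### Contravariant valuations are simple -/

section Simple

variable {n : ℕ} {p : ℝ}

/-- The properties of `(X, u) ↦ h(Φ X, u) ^ p`, for an `SL(n)`-contravariant `L_p`-Minkowski
valuation `Φ`, on which the classification is based. The valuation property is only recorded for
cuts by hyperplanes through the origin. -/
structure IsContraVal (p : ℝ) (z : Set (E n) → E n → ℝ) : Prop where
  nonneg : ∀ X u, 0 ≤ z X u
  continuous : ∀ X, Continuous (z X)
  smul : ∀ X (c : ℝ), 0 < c → ∀ u, z X (c • u) = c ^ p * z X u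
  cut : ∀ X, IsPolyO X → ∀ (l : Module.Dual ℝ (E n)) (u : E n),
    z X u + z (X ∩ {x | l x = 0}) u = z (X ∩ {x | 0 ≤ l x}) u + z (X ∩ {x | l x ≤ 0}) u
  map : ∀ f : E n →ₗ[ℝ] E n, LinearMap.det f = 1 → ∀ X, IsPolyO X → ∀ u,
    z (f '' X) (f u) = z X u

variable {z : Set (E n) → E n → ℝ}

/-- For `X` in the hyperplane `v^⊥`, shears fixing this hyperplane leave `X` unchanged. -/
theorem IsContraVal.eq_of_inner_eq (hz : IsContraVal p z) {X : Set (E n)} (hX : IsPolyO X)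
    {v : E n} (hXv : ∀ x ∈ X, inner ℝ v x = 0) {u u' : E n} (h : inner ℝ v u = inner ℝ v u')
    (hu : inner ℝ v u ≠ 0) : z X u = z X u' := by
  set f := LinearMap.transvection (innerₛₗ ℝ v) ((inner ℝ v u)⁻¹ • (u' - u)) with hf
  have hdet : LinearMap.det f = 1 := by
    rw [hf, LinearMap.transvection.det]
    simp [inner_sub_right, h]
  have hfX : f '' X = X := by
    have : ∀ x ∈ X, f x = x := fun x hx => by
      rw [hf, LinearMap.transvection.apply, innerₛₗ_apply_apply, hXv x hx, zero_smul, add_zero]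
    rw [Set.image_congr this, Set.image_id']
  have hfu : f u = u' := by
    rw [hf, LinearMap.transvection.apply, innerₛₗ_apply_apply, smul_smul, mul_inv_cancel₀ hu,
      one_smul, add_sub_cancel]
  have := hz.map f hdet X hX u
  rw [hfX, hfu] at this
  exact this.symm

theorem IsContraVal.eq_zero_of_inner_eq_zero (hz : IsContraVal p z) (hp : 1 < p) {X : Set (E n)}
    (hX : IsPolyO X) {v : E n} (hv : v ≠ 0) (hXv : ∀ x ∈ X, inner ℝ v x = 0) {u : E n}
    (hu : inner ℝ v u = 0) : z X u = 0 := by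
  have hvv : 0 < inner ℝ v v := real_inner_self_pos.2 hv
  -- `z X (u + ε v) = z X (ε v) = ε ^ p z X v` tends to `0`
  have h1 : Filter.Tendsto (fun ε : ℝ => z X (u + ε • v)) (nhdsWithin 0 (Set.Ioi 0))
      (nhds (z X u)) := by
    have : Continuous fun ε : ℝ => z X (u + ε • v) := (hz.continuous X).comp (by fun_prop)
    have h := this.tendsto 0
    simp only [zero_smul, add_zero] at h
    exact h.mono_left nhdsWithin_le_nhds
  have h2 : Filter.Tendsto (fun ε : ℝ => ε ^ p * z X v) (nhdsWithin 0 (Set.Ioi 0)) (nhds 0) := by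
    have : Continuous fun ε : ℝ => ε ^ p * z X v :=
      (Real.continuous_rpow_const (by linarith)).mul continuous_const
    have h := this.tendsto 0
    rw [Real.zero_rpow (by linarith), zero_mul] at h
    exact h.mono_left nhdsWithin_le_nhds
  refine tendsto_nhds_unique (h1.congr' ?_) h2
  filter_upwards [self_mem_nhdsWithin] with ε hε
  have hε : 0 < ε := hε
  rw [← hz.smul X ε hε]
  refine hz.eq_of_inner_eq hX hXv ?_ ?_
  · rw [inner_add_right, hu, zero_add]
  · rw [inner_add_right, hu, zero_add, real_inner_smul_right]
    positivity

theorem IsContraVal.eq_zero_of_two_normals (hz : IsContraVal p z) (hp : 1 < p) {X : Set (E n)}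
    (hX : IsPolyO X) {v w : E n} (hv : v ≠ 0) (hw : w ≠ 0) (hvw : inner ℝ v w = 0)
    (hXv : ∀ x ∈ X, inner ℝ v x = 0) (hXw : ∀ x ∈ X, inner ℝ w x = 0) (u : E n) : z X u = 0 := by
  by_cases hu : inner ℝ v u = 0
  · exact hz.eq_zero_of_inner_eq_zero hp hX hv hXv hu
  · have hww : inner ℝ w w ≠ 0 := (real_inner_self_pos.2 hw).ne'
    rw [hz.eq_of_inner_eq hX hXv (u' := u - (inner ℝ w u / inner ℝ w w) • w) _ hu]
    · refine hz.eq_zero_of_inner_eq_zero hp hX hw hXw ?_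
      rw [inner_sub_right, real_inner_smul_right, div_mul_cancel₀ _ hww, sub_self]
    · rw [inner_sub_right, real_inner_smul_right, hvw, mul_zero, sub_zero]

/-- A contravariant valuation vanishes on polytopes in a hyperplane `v^⊥`. There the function
`X ↦ z X v` is simple, and it is homogeneous with exponent `p` with respect to the volume of
`v^⊥`: halving a simplex shows that it vanishes on simplices, since `2 * 2 ^ (-p) ≠ 1`. -/
theorem IsContraVal.eq_zero_of_hyperplane (hz : IsContraVal p z) (hp : 1 < p) (hn : 3 ≤ n)
    {X : Set (E n)} (hX : IsPolyO X) {v : E n} (hv : v ≠ 0) (hXv : ∀ x ∈ X, inner ℝ v x = 0)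
    (u : E n) : z X u = 0 := by
  classical
  have hvv : 0 < inner ℝ v v := real_inner_self_pos.2 hv
  set H : Submodule ℝ (E n) := (ℝ ∙ v)ᗮ with hH
  have memH : ∀ {x}, x ∈ H ↔ inner ℝ v x = 0 := fun {x} => by
    rw [hH, Submodule.mem_orthogonal_singleton_iff_inner_right]
  have hvH : ∀ y : H, inner ℝ v (y : E n) = 0 := fun y => memH.1 y.2
  by_cases hu : inner ℝ v u = 0
  · exact hz.eq_zero_of_inner_eq_zero hp hX hv hXv hu
  have hut : z X u = z X ((inner ℝ v u / inner ℝ v v) • v) := by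
    refine hz.eq_of_inner_eq hX hXv ?_ hu
    rw [real_inner_smul_right, div_mul_cancel₀ _ hvv.ne']
  rw [hut]
  generalize inner ℝ v u / inner ℝ v v = t
  have hfin : Module.finrank ℝ (Fin (n - 1) → ℝ) = Module.finrank ℝ H := by
    have := (ℝ ∙ v).finrank_add_finrank_orthogonal
    rw [finrank_span_singleton hv, finrank_euclideanSpace_fin, ← hH] at this
    rw [Module.finrank_fin_fun]
    omega
  let e : (Fin (n - 1) → ℝ) ≃ₗ[ℝ] H := LinearEquiv.ofFinrankEq _ _ hfin
  let r : Module.Dual ℝ H → H := fun l =>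
    (InnerProductSpace.toDual ℝ H).symm (LinearMap.toContinuousLinearMap l)
  have hr : ∀ l (y : H), inner ℝ ((r l : H) : E n) (y : E n) = l y := fun l y => by
    rw [← Submodule.coe_inner, InnerProductSpace.toDual_symm_apply]
    rfl
  have hr0 : ∀ l : Module.Dual ℝ H, l ≠ 0 → ((r l : H) : E n) ≠ 0 := by
    intro l hl h0
    refine hl (LinearMap.ext fun y => ?_)
    rw [← hr l y, h0, inner_zero_left]
    rfl
  have himg : ∀ Y : Set H, IsPolyO Y → IsPolyO (H.subtype '' Y) := fun Y hY => hY.image H.subtype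
  have hlow : ∀ Y : Set H, IsPolyO Y → ∀ l : Module.Dual ℝ H, l ≠ 0 → (∀ x ∈ Y, l x = 0) →
      z (H.subtype '' Y) (t • v) = 0 := by
    intro Y hY l hl hYl
    refine hz.eq_zero_of_two_normals hp (himg Y hY) hv (hr0 l hl) (hvH _) ?_ ?_ _
    · rintro _ ⟨y, -, rfl⟩
      exact hvH y
    · rintro _ ⟨y, hy, rfl⟩
      rw [Submodule.subtype_apply, hr, hYl y hy]
  have hcut : ∀ Y : Set H, IsPolyO Y → ∀ l : Module.Dual ℝ H, l ≠ 0 →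
      z (H.subtype '' Y) (t • v) = z (H.subtype '' (Y ∩ {x | 0 ≤ l x})) (t • v)
        + z (H.subtype '' (Y ∩ {x | l x ≤ 0})) (t • v) := by
    intro Y hY l hl
    have h := hz.cut _ (himg Y hY) (innerₛₗ ℝ ((r l : H) : E n)) (t • v)
    have hset : ∀ s : Set ℝ, H.subtype '' Y ∩ {x | innerₛₗ ℝ ((r l : H) : E n) x ∈ s}
        = H.subtype '' (Y ∩ {x | l x ∈ s}) := by
      intro s
      ext x
      simp only [Set.mem_inter_iff, Set.mem_image, Set.mem_ofPred_eq, innerₛₗ_apply_apply,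
        Submodule.subtype_apply]
      constructor
      · rintro ⟨⟨y, hy, rfl⟩, hs⟩
        exact ⟨y, ⟨hy, by rwa [hr] at hs⟩, rfl⟩
      · rintro ⟨y, ⟨hy, hs⟩, rfl⟩
        exact ⟨⟨y, hy, rfl⟩, by rwa [hr]⟩
    have e1 := hset (Set.Ici 0)
    have e2 := hset (Set.Iic 0)
    have e3 := hset {0}
    simp only [Set.mem_Ici, Set.mem_Iic, Set.mem_singleton_iff] at e1 e2 e3
    rw [e1, e2, e3, hlow _ (hY.inter_eq_zero l) l hl fun x hx => hx.2, add_zero] at h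
    exact h
  have hsimplex : ∀ ψ : (Fin (n - 1) → ℝ) ≃ₗ[ℝ] H,
      z (H.subtype '' (ψ '' stdSolid (Fin (n - 1)))) (t • v) = 0 := by
    intro ψ
    have hT : IsPolyO (ψ '' stdSolid (Fin (n - 1))) := isPolyO_stdSolid.image ψ.toLinearMap
    -- each half of the simplex is the image of the whole one under a map that doubles `v`
    have hhalf : ∀ i j : Fin (n - 1), i ≠ j →
        z (H.subtype '' (ψ '' (edgeMap i j (1 / 2) '' stdSolid (Fin (n - 1))))) (t • v)
          = (2 : ℝ) ^ (-p) * z (H.subtype '' (ψ '' stdSolid (Fin (n - 1)))) (t • v) := by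
      intro i j hij
      let k : Module.Dual ℝ H := LinearMap.proj j ∘ₗ ψ.symm.toLinearMap
      let w : H := (1 / 2 : ℝ) • (ψ (Pi.single i 1) - ψ (Pi.single j 1))
      let f₁ := LinearMap.transvection (innerₛₗ ℝ ((r k : H) : E n)) (w : E n)
      let f₂ := LinearMap.transvection ((inner ℝ v v)⁻¹ • innerₛₗ ℝ v) v
      have hkw : k w = -(1 / 2) := by
        simp [k, w, hij.symm]
      have hdet : LinearMap.det (f₂ ∘ₗ f₁) = 1 := by
        rw [LinearMap.det_comp, LinearMap.transvection.det, LinearMap.transvection.det,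
          innerₛₗ_apply_apply, hr, hkw, LinearMap.smul_apply, innerₛₗ_apply_apply, smul_eq_mul,
          inv_mul_cancel₀ hvv.ne']
        norm_num
      have hf₂ : ∀ y : H, f₂ (y : E n) = y := by
        intro y
        rw [LinearMap.transvection.apply, LinearMap.smul_apply, innerₛₗ_apply_apply, hvH,
          smul_zero, zero_smul, add_zero]
      have hf : ∀ y, (f₂ ∘ₗ f₁) (ψ y : E n) = ψ (edgeMap i j (1 / 2) y) := by
        intro y
        have h1 : f₁ (ψ y : E n) = ((ψ (edgeMap i j (1 / 2) y) : H) : E n) := by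
          rw [LinearMap.transvection.apply, innerₛₗ_apply_apply, hr, edgeMap,
            LinearMap.transvection.apply, map_add, map_smul, map_smul, map_sub]
          simp [k, w]
        rw [LinearMap.comp_apply, h1, hf₂]
      have hfv : (f₂ ∘ₗ f₁) (t • v) = (2 : ℝ) • t • v := by
        have h1 : f₁ v = v := by
          rw [LinearMap.transvection.apply, innerₛₗ_apply_apply, real_inner_comm, hvH, zero_smul,
            add_zero]
        have h2 : f₂ v = (2 : ℝ) • v := by
          rw [LinearMap.transvection.apply, LinearMap.smul_apply, innerₛₗ_apply_apply, smul_eq_mul,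
            inv_mul_cancel₀ hvv.ne', one_smul, two_smul]
        rw [map_smul, LinearMap.comp_apply, h1, h2, smul_comm]
      have himage : (f₂ ∘ₗ f₁) '' (H.subtype '' (ψ '' stdSolid (Fin (n - 1))))
          = H.subtype '' (ψ '' (edgeMap i j (1 / 2) '' stdSolid (Fin (n - 1)))) := by
        simp only [Set.image_image, Submodule.subtype_apply, hf]
      have := hz.map _ hdet _ (himg _ hT) (t • v)
      rw [himage, hfv, hz.smul _ 2 two_pos] at this
      rw [← this, ← mul_assoc, ← Real.rpow_add two_pos, neg_add_cancel, Real.rpow_zero, one_mul]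
    let i : Fin (n - 1) := ⟨0, by omega⟩
    let j : Fin (n - 1) := ⟨1, by omega⟩
    have hij : i ≠ j := by simp [i, j]
    let l : Module.Dual ℝ H := (1 / 2 : ℝ) •
      ((LinearMap.proj i : (Fin (n - 1) → ℝ) →ₗ[ℝ] ℝ) -
        (LinearMap.proj j : (Fin (n - 1) → ℝ) →ₗ[ℝ] ℝ)) ∘ₗ ψ.symm.toLinearMap
    have hl : l ≠ 0 := fun h => by
      have := LinearMap.congr_fun h (ψ (Pi.single i 1))
      simp [l, hij.symm] at this
    have h := hcut _ hT l hl
    have e1 : ψ '' stdSolid (Fin (n - 1)) ∩ {x | 0 ≤ l x}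
        = ψ '' (edgeMap i j (1 / 2) '' stdSolid (Fin (n - 1))) := by
      rw [image_edgeMap_stdSolid hij (by norm_num) (by norm_num), Set.image_inter ψ.injective]
      congr 1
      ext x
      rw [LinearEquiv.image_eq_preimage_symm]
      simp [l]
      norm_num
    have e2 : ψ '' stdSolid (Fin (n - 1)) ∩ {x | l x ≤ 0}
        = ψ '' (edgeMap j i (1 / 2) '' stdSolid (Fin (n - 1))) := by
      rw [image_edgeMap_stdSolid hij.symm (by norm_num) (by norm_num), Set.image_inter ψ.injective]
      congr 1
      ext x
      rw [LinearEquiv.image_eq_preimage_symm]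
      simp [l]
      norm_num
      constructor <;> intro _ <;> linarith
    rw [e1, e2, hhalf i j hij, hhalf j i hij.symm] at h
    have h2 : (2 : ℝ) ^ (-p) < 2⁻¹ := by
      rw [← Real.rpow_neg_one]
      exact Real.rpow_lt_rpow_of_exponent_lt one_lt_two (by linarith)
    have h3 := hz.nonneg (H.subtype '' (ψ '' stdSolid (Fin (n - 1)))) (t • v)
    nlinarith
  have hpre : X = H.subtype '' (H.subtype ⁻¹' X) := by
    rw [Set.image_preimage_eq_inter_range, Set.inter_eq_left.2]
    intro x hx
    exact ⟨⟨x, memH.2 (hXv x hx)⟩, rfl⟩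
  have hpoly : IsPolyO (H.subtype ⁻¹' X) := by
    have hproj : H.subtype ⁻¹' X = H.orthogonalProjectionOnto.toLinearMap '' X := by
      ext y
      constructor
      · intro hy
        exact ⟨y, hy, by simp⟩
      · rintro ⟨x, hx, rfl⟩
        have : H.starProjection x = x :=
          Submodule.starProjection_eq_self_iff.2 (memH.2 (hXv x hx))
        simpa [this] using hx
    rw [hproj]
    exact hX.image _
  rw [hpre]
  exact eq_zero_of_simplex_eq_zero e (fun Y => z (H.subtype '' Y) (t • v)) hcut hlow hsimplex hpoly

theorem IsContraVal.eq_zero_of_dual (hz : IsContraVal p z) (hp : 1 < p) (hn : 3 ≤ n)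
    {X : Set (E n)} (hX : IsPolyO X) {l : Module.Dual ℝ (E n)} (hl : l ≠ 0)
    (hXl : ∀ x ∈ X, l x = 0) (u : E n) : z X u = 0 := by
  let v := (InnerProductSpace.toDual ℝ (E n)).symm (LinearMap.toContinuousLinearMap l)
  have hv : ∀ x, inner ℝ v x = l x := fun x => InnerProductSpace.toDual_symm_apply
  refine hz.eq_zero_of_hyperplane hp hn hX (v := v) (fun h0 => hl (LinearMap.ext fun x => ?_))
    (fun x hx => by rw [hv, hXl x hx]) u
  rw [← hv, h0, inner_zero_left]
  rfl

theorem IsContraVal.eq_add (hz : IsContraVal p z) (hp : 1 < p) (hn : 3 ≤ n)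
    {X : Set (E n)} (hX : IsPolyO X) {l : Module.Dual ℝ (E n)} (hl : l ≠ 0) (u : E n) :
    z X u = z (X ∩ {x | 0 ≤ l x}) u + z (X ∩ {x | l x ≤ 0}) u := by
  rw [← hz.cut X hX l u, hz.eq_zero_of_dual hp hn (hX.inter_eq_zero l) hl fun x hx => hx.2,
    add_zero]

end Simple

/-! ### Contravariant valuations on simplices -/

section Simplex

variable {n : ℕ} {p : ℝ} {z : Set (E n) → E n → ℝ}

/-- The determinant of the basis `φ e_i` of `E n`. -/
noncomputable def basisDet (φ : (Fin n → ℝ) ≃ₗ[ℝ] E n) : ℝ :=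
  LinearMap.det (φ.toLinearMap ∘ₗ (WithLp.linearEquiv 2 ℝ (Fin n → ℝ)).toLinearMap)

theorem basisDet_trans (A : (Fin n → ℝ) ≃ₗ[ℝ] (Fin n → ℝ)) (φ : (Fin n → ℝ) ≃ₗ[ℝ] E n) :
    basisDet (A.trans φ) = LinearMap.det (A : (Fin n → ℝ) →ₗ[ℝ] (Fin n → ℝ)) * basisDet φ := by
  let e := WithLp.linearEquiv 2 ℝ (Fin n → ℝ)
  have h : (A.trans φ).toLinearMap ∘ₗ e.toLinearMap
      = (φ.toLinearMap ∘ₗ e.toLinearMap) ∘ₗ (e.symm.toLinearMap ∘ₗ A.toLinearMap ∘ₗ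
        e.symm.symm.toLinearMap) := by
    ext x
    simp [e]
  rw [basisDet, h, LinearMap.det_comp, LinearMap.det_conj, mul_comm]
  rfl

theorem basisDet_ne_zero (φ : (Fin n → ℝ) ≃ₗ[ℝ] E n) : basisDet φ ≠ 0 :=
  (LinearEquiv.isUnit_det' ((WithLp.linearEquiv 2 ℝ (Fin n → ℝ)).trans φ)).ne_zero

theorem exists_basisDet_eq (hn : 1 ≤ n) {d : ℝ} (hd : d ≠ 0) :
    ∃ φ : (Fin n → ℝ) ≃ₗ[ℝ] E n, basisDet φ = d := by
  let i : Fin n := ⟨0, hn⟩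
  let f := LinearMap.transvection (LinearMap.proj i : (Fin n → ℝ) →ₗ[ℝ] ℝ)
    ((d - 1) • Pi.single i 1)
  have hf : LinearMap.det f = d := by
    rw [LinearMap.transvection.det]
    simp
  let A := LinearMap.equivOfDetNeZero f (hf ▸ hd)
  refine ⟨A.trans (WithLp.linearEquiv 2 ℝ (Fin n → ℝ)).symm, ?_⟩
  rw [basisDet_trans, basisDet]
  have h1 : (WithLp.linearEquiv 2 ℝ (Fin n → ℝ)).symm.toLinearMap ∘ₗ
      (WithLp.linearEquiv 2 ℝ (Fin n → ℝ)).toLinearMap = LinearMap.id := by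
    ext x
    simp
  rw [h1, LinearMap.det_id, mul_one]
  exact hf

theorem isPolyO_image_stdSolid (φ : (Fin n → ℝ) ≃ₗ[ℝ] E n) : IsPolyO (φ '' stdSolid (Fin n)) :=
  isPolyO_stdSolid.image φ.toLinearMap

/-- The value of a contravariant valuation on a simplex depends only on the determinant of the
simplex and on the coordinates of the argument with respect to its edges. -/
theorem IsContraVal.eq_of_basisDet_eq (hz : IsContraVal p z) {φ ψ : (Fin n → ℝ) ≃ₗ[ℝ] E n}
    (h : basisDet φ = basisDet ψ) (y : Fin n → ℝ) :
    z (φ '' stdSolid (Fin n)) (φ y) = z (ψ '' stdSolid (Fin n)) (ψ y) := by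
  let e := WithLp.linearEquiv 2 ℝ (Fin n → ℝ)
  set f := (φ.symm.trans ψ).toLinearMap with hf
  have hfφ : ∀ y, f (φ y) = ψ y := fun y => by simp [hf]
  have hdet : LinearMap.det f = 1 := by
    have h1 : ψ.toLinearMap ∘ₗ e.toLinearMap = f ∘ₗ (φ.toLinearMap ∘ₗ e.toLinearMap) := by
      ext x
      simp [hf]
    have h2 : basisDet ψ = LinearMap.det f * basisDet φ := by
      rw [basisDet, h1, LinearMap.det_comp]
      rfl
    rw [← h] at h2
    exact mul_right_cancel₀ (basisDet_ne_zero φ) (by rw [one_mul, ← h2])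
  have := hz.map f hdet _ (isPolyO_image_stdSolid φ) (φ y)
  rw [hfφ, Set.image_image] at this
  simp only [hfφ] at this
  exact this.symm

/-- The value of `z` at the point with coordinates `y`, for a simplex with determinant `d`; the junk
value is `0` if `d = 0`, as there is no such simplex. -/
noncomputable def simplexFun (z : Set (E n) → E n → ℝ) (d : ℝ) (y : Fin n → ℝ) : ℝ :=
  open Classical in
  if h : ∃ φ : (Fin n → ℝ) ≃ₗ[ℝ] E n, basisDet φ = d then
    z (h.choose '' stdSolid (Fin n)) (h.choose y) else 0

theorem IsContraVal.simplexFun_basisDet (hz : IsContraVal p z) (φ : (Fin n → ℝ) ≃ₗ[ℝ] E n)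
    (y : Fin n → ℝ) : simplexFun z (basisDet φ) y = z (φ '' stdSolid (Fin n)) (φ y) := by
  have h : ∃ ψ : (Fin n → ℝ) ≃ₗ[ℝ] E n, basisDet ψ = basisDet φ := ⟨φ, rfl⟩
  rw [simplexFun, dif_pos h]
  exact hz.eq_of_basisDet_eq h.choose_spec y

theorem IsContraVal.simplexFun_nonneg (hz : IsContraVal p z) (d : ℝ) (y : Fin n → ℝ) :
    0 ≤ simplexFun z d y := by
  rw [simplexFun]
  split_ifs
  · exact hz.nonneg _ _
  · exact le_rfl

theorem IsContraVal.continuous_simplexFun (hz : IsContraVal p z) (d : ℝ) :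
    Continuous (simplexFun z d) := by
  by_cases h : ∃ ψ : (Fin n → ℝ) ≃ₗ[ℝ] E n, basisDet ψ = d
  · have : simplexFun z d = fun y => z (h.choose '' stdSolid (Fin n)) (h.choose y) := by
      ext y
      rw [simplexFun, dif_pos h]
    rw [this]
    exact (hz.continuous _).comp (LinearMap.continuous_of_finiteDimensional
      (h.choose.toLinearMap))
  · have : simplexFun z d = fun _ => 0 := by
      ext y
      rw [simplexFun, dif_neg h]
    rw [this]
    exact continuous_const

theorem IsContraVal.simplexFun_smul (hz : IsContraVal p z) (d : ℝ) {c : ℝ} (hc : 0 < c)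
    (y : Fin n → ℝ) : simplexFun z d (c • y) = c ^ p * simplexFun z d y := by
  rw [simplexFun, simplexFun]
  split_ifs
  · rw [map_smul, hz.smul _ c hc]
  · rw [mul_zero]

/-- The functional equation obtained by cutting a simplex along an edge. -/
theorem IsContraVal.simplexFun_cut (hz : IsContraVal p z) (hp : 1 < p) (hn : 3 ≤ n) {d : ℝ}
    (hd : d ≠ 0) {i j : Fin n} (hij : i ≠ j) {c : ℝ} (h0 : 0 < c) (h1 : c < 1)
    {y y₁ y₂ : Fin n → ℝ} (hy₁ : edgeMap i j c y₁ = y) (hy₂ : edgeMap j i (1 - c) y₂ = y) :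
    simplexFun z d y = simplexFun z ((1 - c) * d) y₁ + simplexFun z (c * d) y₂ := by
  obtain ⟨φ, rfl⟩ := exists_basisDet_eq (by omega : 1 ≤ n) hd
  have hc : 1 - c ≠ 1 := by linarith
  have hd₁ : basisDet ((edgeEquiv hij h1.ne).trans φ) = (1 - c) * basisDet φ := by
    rw [basisDet_trans]
    congr 1
    exact det_edgeMap hij c
  have hd₂ : basisDet ((edgeEquiv hij.symm hc).trans φ) = c * basisDet φ := by
    rw [basisDet_trans]
    congr 1
    exact (det_edgeMap hij.symm (1 - c)).trans (by ring)
  have e₁ : (edgeEquiv hij h1.ne).trans φ y₁ = φ y := by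
    rw [LinearEquiv.trans_apply, edgeEquiv_apply, hy₁]
  have e₂ : (edgeEquiv hij.symm hc).trans φ y₂ = φ y := by
    rw [LinearEquiv.trans_apply, edgeEquiv_apply, hy₂]
  rw [← hd₁, ← hd₂, hz.simplexFun_basisDet, hz.simplexFun_basisDet, hz.simplexFun_basisDet, e₁, e₂,
    image_edgeEquiv_trans, image_edgeEquiv_trans, image_edgeMap_stdSolid hij h0.le h1,
    image_edgeMap_stdSolid hij.symm (by linarith) (by linarith), Set.image_inter φ.injective,
    Set.image_inter φ.injective]
  let k : Fin n → Module.Dual ℝ (E n) := fun i =>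
    (LinearMap.proj i : (Fin n → ℝ) →ₗ[ℝ] ℝ) ∘ₗ φ.symm.toLinearMap
  have hk : (1 - c) • k i - c • k j ≠ 0 := fun h => by
    have := LinearMap.congr_fun h (φ (Pi.single i 1))
    simp [k, hij.symm, sub_eq_zero, h1.ne'] at this
  rw [hz.eq_add hp hn (isPolyO_image_stdSolid φ) hk]
  congr 3
  · ext x
    rw [LinearEquiv.image_eq_preimage_symm]
    simp [k]
  · ext x
    rw [LinearEquiv.image_eq_preimage_symm]
    simp [k]

/-- Interchanging two vertices changes the sign of the determinant. -/
theorem IsContraVal.simplexFun_swap (hz : IsContraVal p z) (hn : 1 ≤ n) {d : ℝ} (hd : d ≠ 0)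
    {i j : Fin n} (hij : i ≠ j) (y : Fin n → ℝ) :
    simplexFun z (-d) (fun k => y (Equiv.swap i j k)) = simplexFun z d y := by
  obtain ⟨φ, rfl⟩ := exists_basisDet_eq hn hd
  let A : (Fin n → ℝ) ≃ₗ[ℝ] (Fin n → ℝ) := LinearEquiv.funCongrLeft ℝ ℝ (Equiv.swap i j)
  have hA : ∀ y k, A y k = y (Equiv.swap i j k) := fun y k => rfl
  have hA' : A.toLinearMap = LinearMap.transvection
      ((LinearMap.proj i : (Fin n → ℝ) →ₗ[ℝ] ℝ) - LinearMap.proj j)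
      (Pi.single j 1 - Pi.single i 1) := by
    refine LinearMap.ext fun y => funext fun k => ?_
    rw [LinearMap.transvection.apply, LinearEquiv.coe_coe, hA]
    simp only [LinearMap.sub_apply, LinearMap.proj_apply, Pi.add_apply, Pi.smul_apply,
      Pi.sub_apply, smul_eq_mul]
    rcases eq_or_ne k i with rfl | hki
    · simp [hij]
    · rcases eq_or_ne k j with rfl | hkj
      · simp [hij.symm]
      · simp [hki, hkj, Equiv.swap_apply_of_ne_of_ne hki hkj]
  have hdet : basisDet (A.trans φ) = -basisDet φ := by
    rw [basisDet_trans, hA', LinearMap.transvection.det]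
    simp [hij, hij.symm]
  have hAA : ∀ y, A (A y) = y := fun y => funext fun k => by
    rw [hA, hA, Equiv.swap_apply_self]
  have hAT : A '' stdSolid (Fin n) = stdSolid (Fin n) := by
    have hsub : ∀ y ∈ stdSolid (Fin n), A y ∈ stdSolid (Fin n) := fun y hy =>
      ⟨fun k => hy.1 _, (Equiv.sum_comp (Equiv.swap i j) y).trans_le hy.2⟩
    refine Set.Subset.antisymm (Set.image_subset_iff.2 hsub) fun y hy => ⟨A y, hsub y hy, hAA y⟩
  have himg : (A.trans φ) '' stdSolid (Fin n) = φ '' stdSolid (Fin n) := by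
    conv_rhs => rw [← hAT, Set.image_image]
    rfl
  rw [← hdet, hz.simplexFun_basisDet, hz.simplexFun_basisDet, himg]
  change z _ (φ (A (A y))) = _
  rw [hAA]

/-- Cauchy's functional equation on the positive half-line, for nonnegative functions. -/
theorem eq_mul_of_additive_of_nonneg {f : ℝ → ℝ}
    (hadd : ∀ s t, 0 < s → 0 < t → f (s + t) = f s + f t) (hf : ∀ s, 0 < s → 0 ≤ f s)
    {d : ℝ} (hd : 0 < d) : f d = d * f 1 := by
  have hmono : ∀ s t, 0 < s → s ≤ t → f s ≤ f t := by
    intro s t hs hst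
    rcases hst.eq_or_lt with rfl | hlt
    · exact le_rfl
    · have := hadd s (t - s) hs (by linarith)
      rw [add_sub_cancel] at this
      linarith [hf (t - s) (by linarith)]
  have hmul : ∀ (m : ℕ) (s : ℝ), 0 < s → f ((m + 1 : ℕ) * s) = (m + 1 : ℕ) * f s := by
    intro m s hs
    induction m with
    | zero => simp
    | succ m ih =>
      have : ((m + 1 + 1 : ℕ) : ℝ) * s = (m + 1 : ℕ) * s + s := by push_cast; ring
      rw [this, hadd _ _ (by positivity) hs, ih]
      push_cast
      ring
  have h1 : 0 ≤ f 1 := hf 1 one_pos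
  -- compare `(N + 1) d` with its integer part
  have key : ∀ N : ℕ, |f d - d * f 1| * (N + 1 : ℕ) ≤ f 1 := by
    intro N
    set m := ⌊((N + 1 : ℕ) : ℝ) * d⌋₊ with hm
    have hpos : 0 < ((N + 1 : ℕ) : ℝ) * d := by positivity
    have hle : (m : ℝ) ≤ ((N + 1 : ℕ) : ℝ) * d := Nat.floor_le hpos.le
    have hlt : ((N + 1 : ℕ) : ℝ) * d < m + 1 := Nat.lt_floor_add_one _
    have e1 := hmul N d hd
    have up : f (((N + 1 : ℕ) : ℝ) * d) ≤ (m + 1) * f 1 := by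
      have := hmono _ _ hpos hlt.le
      have h2 := hmul m 1 one_pos
      rw [mul_one] at h2
      push_cast at h2
      rwa [h2] at this
    have low : (m : ℝ) * f 1 ≤ f (((N + 1 : ℕ) : ℝ) * d) := by
      rcases Nat.eq_zero_or_pos m with h0 | h0
      · rw [h0]
        simpa using hf _ hpos
      · obtain ⟨k, hk⟩ := Nat.exists_eq_succ_of_ne_zero h0.ne'
        rw [hk] at hle ⊢
        have := hmono _ _ (by positivity) hle
        have h2 := hmul k 1 one_pos
        rw [mul_one] at h2
        rwa [Nat.succ_eq_add_one, h2] at this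
    rw [e1] at up low
    rw [← abs_of_nonneg (by positivity : (0 : ℝ) ≤ (N + 1 : ℕ)), ← abs_mul, abs_le]
    constructor
    · nlinarith
    · nlinarith
  have habs : |f d - d * f 1| ≤ 0 := by
    by_contra hne
    push Not at hne
    obtain ⟨N, hN⟩ := exists_nat_gt (f 1 / |f d - d * f 1|)
    rw [div_lt_iff₀ hne] at hN
    have := key N
    push_cast at this
    nlinarith
  linarith [abs_nonpos_iff.1 habs]

theorem edgeMap_eq_self {i j : Fin n} (c : ℝ) {y : Fin n → ℝ} (hy : y j = 0) :
    edgeMap i j c y = y := by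
  simp [edgeMap, LinearMap.transvection.apply, hy]

/-- If two coordinates of `y` vanish, the functional equation becomes Cauchy's equation for the
dependence on the determinant. As `n ≥ 3`, this applies to the multiples of unit vectors. -/
theorem IsContraVal.simplexFun_eq_mul (hz : IsContraVal p z) (hp : 1 < p) (hn : 3 ≤ n)
    {i j : Fin n} (hij : i ≠ j) {y : Fin n → ℝ} (hi : y i = 0) (hj : y j = 0) {d : ℝ}
    (hd : 0 < d) : simplexFun z d y = d * simplexFun z 1 y := by
  refine eq_mul_of_additive_of_nonneg (f := fun d => simplexFun z d y) ?_
    (fun s _ => hz.simplexFun_nonneg s y) hd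
  intro s t hs ht
  have h := hz.simplexFun_cut hp hn (by positivity : s + t ≠ 0) hij (c := t / (s + t))
    (by positivity) ((div_lt_one (by positivity)).2 (by linarith)) (edgeMap_eq_self _ hj)
    (edgeMap_eq_self _ hi)
  have e1 : (1 - t / (s + t)) * (s + t) = s := by field_simp; ring
  have e2 : t / (s + t) * (s + t) = t := by field_simp
  rw [e1, e2] at h
  exact h

theorem IsContraVal.simplexFun_single (hz : IsContraVal p z) (hn : 3 ≤ n) (i i' : Fin n) (s : ℝ)
    {d : ℝ} (hd : d ≠ 0) :
    simplexFun z d (Pi.single i s) = simplexFun z d (Pi.single i' s) := by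
  rcases eq_or_ne i i' with rfl | hii
  · rfl
  have hcomp : ∀ j k l : Fin n, (fun m => (Pi.single l s : Fin n → ℝ) (Equiv.swap j k m))
      = Pi.single (Equiv.swap j k l) s := by
    intro j k l
    ext m
    simp only [Pi.single_apply, Equiv.swap_apply_eq_iff]
  obtain ⟨k, hki, hki'⟩ : ∃ k : Fin n, k ≠ i ∧ k ≠ i' := by
    have : ({i, i'} : Finset (Fin n)).card < Fintype.card (Fin n) := by
      rw [Fintype.card_fin]
      exact Finset.card_le_two.trans_lt (by omega)
    obtain ⟨k, hk⟩ := Finset.exists_mem_notMem_of_card_lt_card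
      (s := {i, i'}) (t := Finset.univ) (by simpa using this)
    exact ⟨k, by simpa [not_or] using hk.2⟩
  -- an even permutation of the vertices taking `i` to `i'`
  have h1 := hz.simplexFun_swap (by omega) hd hii (Pi.single i s)
  have h2 := hz.simplexFun_swap (by omega) hd hki (Pi.single i' s)
  rw [hcomp, Equiv.swap_apply_left] at h1
  rw [hcomp, Equiv.swap_apply_of_ne_of_ne hki'.symm hii.symm] at h2
  rw [← h1, h2]

/-- Induction on the number of nonzero coordinates of `y`: if `y i` and `y j` are nonzero, a
suitable cut through the edge from `e_i` to `e_j` relates `y` to vectors in which one of them has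
been moved to the other. If `y i + y j = 0`, there is no such cut, and `y` is approximated. -/
theorem IsContraVal.simplexFun_eq (hz : IsContraVal p z) (hp : 1 < p) (hn : 3 ≤ n) (i₀ : Fin n)
    {d : ℝ} (hd : 0 < d) (y : Fin n → ℝ) :
    simplexFun z d y = d * simplexFun z 1 (Pi.single i₀ (∑ k, y k)) := by
  induction hm : (Finset.univ.filter fun k => y k ≠ 0).card
    using Nat.strong_induction_on generalizing y d with
  | _ m ih =>
    by_cases hex : ∃ i j, i ≠ j ∧ y i ≠ 0 ∧ y j ≠ 0
    · obtain ⟨i, j, hij, hi, hj⟩ := hex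
      let move : (Fin n → ℝ) → Fin n → Fin n → Fin n → ℝ := fun x i j =>
        Function.update (Function.update x j 0) i (x i + x j)
      have hmove_i : ∀ (x : Fin n → ℝ) i j, move x i j i = x i + x j := fun x i j => by
        simp [move]
      have hmove_j : ∀ (x : Fin n → ℝ) i j, i ≠ j → move x i j j = 0 := fun x i j h => by
        simp [move, h.symm]
      have hmove_k : ∀ (x : Fin n → ℝ) i j k, k ≠ i → k ≠ j → move x i j k = x k :=
        fun x i j k h h' => by simp [move, h, h']
      have hmove_sum : ∀ (x : Fin n → ℝ) i j, i ≠ j → ∑ k, move x i j k = ∑ k, x k := by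
        intro x i j hij
        rw [← Finset.add_sum_erase _ _ (Finset.mem_univ i),
          ← Finset.add_sum_erase Finset.univ x (Finset.mem_univ i),
          ← Finset.add_sum_erase (Finset.univ.erase i) (move x i j)
            (Finset.mem_erase.2 ⟨hij.symm, Finset.mem_univ j⟩),
          ← Finset.add_sum_erase (Finset.univ.erase i) x
            (Finset.mem_erase.2 ⟨hij.symm, Finset.mem_univ j⟩), hmove_i, hmove_j _ _ _ hij]
        rw [Finset.sum_congr rfl fun k hk => hmove_k x i j k
          (Finset.ne_of_mem_erase (Finset.mem_of_mem_erase hk)) (Finset.ne_of_mem_erase hk)]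
        ring
      have hmoved : ∀ (x : Fin n → ℝ) i j, i ≠ j → x i ≠ 0 → x j ≠ 0 →
          (Finset.univ.filter fun k => x k ≠ 0).card = m → ∀ {d : ℝ}, 0 < d →
          simplexFun z d (move x i j) = d * simplexFun z 1 (Pi.single i₀ (∑ k, x k)) := by
        intro x i j hij hi hj hx d hd
        rw [← hmove_sum x i j hij]
        refine ih _ ?_ hd _ rfl
        rw [← hx]
        refine Finset.card_lt_card ?_
        rw [Finset.ssubset_iff_of_subset]
        · exact ⟨j, by simp [hj], by simp [hmove_j x i j hij]⟩
        · intro k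
          simp only [Finset.mem_filter, Finset.mem_univ, true_and]
          rcases eq_or_ne k i with rfl | hki
          · exact fun _ => hi
          · rcases eq_or_ne k j with rfl | hkj
            · exact fun _ => hj
            · rw [hmove_k x i j k hki hkj]
              exact id
      have hedge : ∀ (x : Fin n → ℝ) (i j : Fin n), i ≠ j → ∀ c : ℝ, c * (x i + x j) = x i →
          edgeMap i j c (move x j i) = x := by
        intro x i j hij c hc
        ext k
        rcases eq_or_ne k i with rfl | hki
        · rw [edgeMap_apply_left hij, hmove_i, hmove_j _ _ _ hij.symm]
          linarith
        · rcases eq_or_ne k j with rfl | hkj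
          · rw [edgeMap_apply_right hij, hmove_i]
            linarith
          · rw [edgeMap_apply_of_ne hki hkj, hmove_k _ _ _ _ hkj hki]
      -- the case of opposite signs, with `x i` dominating
      have hopp : ∀ (x : Fin n → ℝ) (i j : Fin n), i ≠ j → x i ≠ 0 → x j ≠ 0 →
          0 < (x i + x j) / x i → (x i + x j) / x i < 1 →
          (Finset.univ.filter fun k => x k ≠ 0).card = m → ∀ {d : ℝ}, 0 < d →
          simplexFun z d x = d * simplexFun z 1 (Pi.single i₀ (∑ k, x k)) := by
        intro x i j hij hi hj h0 h1 hx d hd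
        set c := (x i + x j) / x i with hc
        have hci : c * x i = x i + x j := div_mul_cancel₀ _ hi
        have hE : edgeMap j i (1 - c) x = move x i j := by
          ext k
          rcases eq_or_ne k j with rfl | hkj
          · rw [edgeMap_apply_left hij.symm, hmove_j _ _ _ hij]
            linarith
          · rcases eq_or_ne k i with rfl | hki
            · rw [edgeMap_apply_right hij.symm, hmove_i]
              linarith
            · rw [edgeMap_apply_of_ne hkj hki, hmove_k _ _ _ _ hki hkj]
        have h := hz.simplexFun_cut hp hn (div_pos hd h0).ne' hij h0 h1
          (edgeMap_eq_self c (hmove_j x i j hij)) hE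
        have e1 : c * (d / c) = d := by field_simp
        rw [e1, hmoved x i j hij hi hj hx (div_pos hd h0),
          hmoved x i j hij hi hj hx (mul_pos (by linarith) (div_pos hd h0))] at h
        linear_combination -h + (simplexFun z 1 (Pi.single i₀ (∑ k, x k))) * e1
      have hne : ∀ (x : Fin n → ℝ), x i ≠ 0 → x j ≠ 0 → x i + x j ≠ 0 →
          (Finset.univ.filter fun k => x k ≠ 0).card = m → ∀ {d : ℝ}, 0 < d →
          simplexFun z d x = d * simplexFun z 1 (Pi.single i₀ (∑ k, x k)) := by
        intro x hi hj hs hx d hd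
        rcases lt_or_gt_of_ne (mul_ne_zero hi hj) with hneg | hpos
        · have hdom : 0 < (x i + x j) / x i ∨ 0 < (x j + x i) / x j := by
            rcases lt_or_gt_of_ne hs with h | h <;> rcases mul_neg_iff.1 hneg with ⟨h1, h2⟩ | ⟨h1, h2⟩
            · exact Or.inr (div_pos_of_neg_of_neg (by linarith) h2)
            · exact Or.inl (div_pos_of_neg_of_neg h h1)
            · exact Or.inl (div_pos h h1)
            · exact Or.inr (div_pos (by linarith) h2)
          have hlt : ∀ a b : ℝ, a ≠ 0 → a * b < 0 → (a + b) / a < 1 := by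
            intro a b ha hab
            have : (a + b) / a = 1 + a * b / a ^ 2 := by field_simp
            rw [this]
            have := div_neg_of_neg_of_pos hab (by positivity : 0 < a ^ 2)
            linarith
          rcases hdom with h | h
          · exact hopp x i j hij hi hj h (hlt _ _ hi hneg) hx hd
          · exact hopp x j i hij.symm hj hi h (hlt _ _ hj (by linarith)) hx hd
        · have h0 : 0 < x i / (x i + x j) := by
            have : x i / (x i + x j) = (x i ^ 2 + x i * x j) / (x i + x j) ^ 2 := by
              field_simp
            rw [this]
            positivity
          have h1 : 0 < x j / (x i + x j) := by
            have : x j / (x i + x j) = (x j ^ 2 + x i * x j) / (x i + x j) ^ 2 := by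
              field_simp
              ring
            rw [this]
            positivity
          have hsum : x i / (x i + x j) + x j / (x i + x j) = 1 := by
            rw [← add_div, div_self hs]
          set c := x i / (x i + x j) with hc
          have hE := hedge x i j hij c (div_mul_cancel₀ _ hs)
          have hE' := hedge x j i hij.symm (1 - c) (by
            have := div_mul_cancel₀ (x i) hs
            rw [← hc] at this
            linarith)
          have h := hz.simplexFun_cut hp hn hd.ne' hij h0 (by linarith) hE hE'
          rw [hmoved x j i hij.symm hj hi hx (mul_pos (by linarith) hd),
            hmoved x i j hij hi hj hx (mul_pos h0 hd)] at h
          rw [h]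
          ring
      by_cases hs : y i + y j = 0
      · -- perturb the coordinate `y i`
        have hcont1 : Continuous fun ε : ℝ => simplexFun z d (Function.update y i (y i + ε)) :=
          (hz.continuous_simplexFun d).comp (continuous_const.update i (by fun_prop))
        have hcont2 : Continuous fun ε : ℝ =>
            d * simplexFun z 1 (Pi.single i₀ (∑ k, y k + ε)) :=
          continuous_const.mul ((hz.continuous_simplexFun 1).comp
            ((continuous_single i₀).comp (by fun_prop)))
        have ht1 := (hcont1.tendsto 0).mono_left (nhdsWithin_le_nhds (s := {0}ᶜ))
        have ht2 := (hcont2.tendsto 0).mono_left (nhdsWithin_le_nhds (s := {0}ᶜ))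
        simp only [add_zero, Function.update_eq_self] at ht1 ht2
        refine tendsto_nhds_unique (ht1.congr' ?_) ht2
        have hnear : ∀ᶠ ε : ℝ in nhdsWithin 0 {0}ᶜ, y i + ε ≠ 0 := by
          refine nhdsWithin_le_nhds ?_
          have : Continuous fun ε : ℝ => y i + ε := by fun_prop
          exact this.continuousAt.eventually_ne (by simpa using hi)
        filter_upwards [hnear, self_mem_nhdsWithin] with ε hε hε0
        have hεi : Function.update y i (y i + ε) i = y i + ε := Function.update_self _ _ _
        have hεj : Function.update y i (y i + ε) j = y j := Function.update_of_ne hij.symm _ _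
        rw [hne _ (by rwa [hεi]) (by rwa [hεj]) ?_ ?_ hd]
        · congr 4
          rw [Finset.sum_update_of_mem (Finset.mem_univ i),
            ← Finset.add_sum_erase Finset.univ y (Finset.mem_univ i), Finset.sdiff_singleton_eq_erase]
          ring
        · rw [hεi, hεj]
          intro h
          exact hε0 (by
            rw [Set.mem_singleton_iff]
            linarith)
        · rw [← hm]
          congr 1
          ext k
          rcases eq_or_ne k i with rfl | hki
          · simp [hε, hi]
          · simp [hki]
      · exact hne y hi hj hs hm hd
    · push Not at hex
      -- at most one coordinate is nonzero
      obtain ⟨i, hi⟩ : ∃ i, y = Pi.single i (∑ k, y k) := by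
        by_cases h0 : ∃ i, y i ≠ 0
        · obtain ⟨i, hi⟩ := h0
          have hz' : ∀ k, k ≠ i → y k = 0 := fun k hk => hex i k hk.symm hi
          refine ⟨i, ?_⟩
          rw [Finset.sum_eq_single i (fun k _ hk => hz' k hk) (by simp)]
          ext k
          rcases eq_or_ne k i with rfl | hk
          · simp
          · simp [hk, hz' k hk]
        · push Not at h0
          exact ⟨i₀, by ext k; simp [h0]⟩
      obtain ⟨j, k, hjk, hji, hki⟩ : ∃ j k : Fin n, j ≠ k ∧ j ≠ i ∧ k ≠ i := by
        have : 1 < (Finset.univ.erase i).card := by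
          rw [Finset.card_erase_of_mem (Finset.mem_univ i), Finset.card_univ, Fintype.card_fin]
          omega
        obtain ⟨j, hj, k, hk, hjk⟩ := Finset.one_lt_card.1 this
        exact ⟨j, k, hjk, Finset.ne_of_mem_erase hj, Finset.ne_of_mem_erase hk⟩
      rw [hz.simplexFun_single hn i₀ i _ one_ne_zero, ← hi]
      exact hz.simplexFun_eq_mul hp hn hjk (by rw [hi]; simp [hji]) (by rw [hi]; simp [hki]) hd

/-- On simplices, a contravariant valuation is a combination of the `p`-th powers of the support
functions of the two projection bodies. -/
theorem IsContraVal.exists_simplex (hz : IsContraVal p z) (hp : 1 < p) (hn : 3 ≤ n) :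
    ∃ k₁ k₂ : ℝ, 0 ≤ k₁ ∧ 0 ≤ k₂ ∧ ∀ (φ : (Fin n → ℝ) ≃ₗ[ℝ] E n) (y : Fin n → ℝ),
      z (φ '' stdSolid (Fin n)) (φ y)
        = |basisDet φ| * (k₁ * max (∑ i, y i) 0 ^ p + k₂ * max (-∑ i, y i) 0 ^ p) := by
  have hp0 : p ≠ 0 := by linarith
  let i₀ : Fin n := ⟨0, by omega⟩
  let i₁ : Fin n := ⟨1, by omega⟩
  have h01 : i₀ ≠ i₁ := by simp [i₀, i₁]
  have hsingle : ∀ c s : ℝ, (Pi.single i₀ (c * s) : Fin n → ℝ) = c • Pi.single i₀ s := by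
    intro c s
    rw [← Pi.single_smul, smul_eq_mul]
  have hK : ∀ s : ℝ, simplexFun z 1 (Pi.single i₀ s)
      = simplexFun z 1 (Pi.single i₀ 1) * max s 0 ^ p
        + simplexFun z 1 (Pi.single i₀ (-1)) * max (-s) 0 ^ p := by
    intro s
    rcases lt_trichotomy s 0 with hs | hs | hs
    · have h := hz.simplexFun_smul 1 (neg_pos.2 hs) (Pi.single i₀ (-1))
      rw [← hsingle] at h
      rw [max_eq_right hs.le, max_eq_left (neg_nonneg.2 hs.le), Real.zero_rpow hp0, mul_zero,
        zero_add, mul_comm, ← h]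
      simp
    · have h := hz.simplexFun_smul 1 (two_pos (α := ℝ)) (0 : Fin n → ℝ)
      rw [smul_zero] at h
      have h2 : (1 : ℝ) < 2 ^ p := Real.one_lt_rpow one_lt_two (by linarith)
      subst hs
      simp only [Pi.single_zero, neg_zero, max_self, Real.zero_rpow hp0, mul_zero, add_zero]
      nlinarith
    · have h := hz.simplexFun_smul 1 hs (Pi.single i₀ 1)
      rw [← hsingle, mul_one] at h
      rw [max_eq_left hs.le, max_eq_right (by linarith), Real.zero_rpow hp0, mul_zero,
        add_zero, mul_comm, ← h]
  refine ⟨_, _, hz.simplexFun_nonneg 1 (Pi.single i₀ 1), hz.simplexFun_nonneg 1 (Pi.single i₀ (-1)),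
    fun φ y => ?_⟩
  rw [← hz.simplexFun_basisDet, ← hK]
  rcases lt_or_gt_of_ne (basisDet_ne_zero φ) with hd | hd
  · have h := hz.simplexFun_swap (by omega) (basisDet_ne_zero φ) h01 y
    rw [← h, hz.simplexFun_eq hp hn i₀ (neg_pos.2 hd), abs_of_neg hd,
      Equiv.sum_comp (Equiv.swap i₀ i₁) y]
  · rw [hz.simplexFun_eq hp hn i₀ hd, abs_of_pos hd]

end Simplex

/-! ### Support functions and convex bodies -/

section Support

variable {n : ℕ} {p : ℝ}

theorem le_of_supp_le {K L : ConvexBody (E n)} (h : ∀ u, supp K u ≤ supp L u) :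
    (K : Set (E n)) ⊆ L := by
  intro x hx
  by_contra hxL
  obtain ⟨f, c, hf, hc⟩ := geometric_hahn_banach_closed_point L.convex L.isCompact.isClosed hxL
  let a : E n := (InnerProductSpace.toDual ℝ (E n)).symm f
  have ha : ∀ y, inner ℝ y a = f y := fun y => by
    rw [real_inner_comm]
    exact InnerProductSpace.toDual_symm_apply
  obtain ⟨y, hy, hya⟩ := exists_inner_eq_supp L a
  have h1 := hf y hy
  have h2 := inner_le_supp K a hx
  rw [ha] at h2 hya
  linarith [h a]

theorem eq_of_supp_rpow_eq (hp : 1 < p) {K L : BodyO n}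
    (h : ∀ u, supp K.1 u ^ p = supp L.1 u ^ p) : K = L := by
  have h' : ∀ u, supp K.1 u = supp L.1 u := fun u =>
    (Real.rpow_left_inj (supp_nonneg K u) (supp_nonneg L u) (by linarith)).1 (h u)
  refine Subtype.ext (ConvexBody.ext ?_)
  exact (le_of_supp_le fun u => (h' u).le).antisymm (le_of_supp_le fun u => (h' u).ge)

theorem continuous_supp (K : ConvexBody (E n)) : Continuous (supp K) := by
  obtain ⟨C, hC⟩ := K.isCompact.isBounded.exists_norm_le
  have hC0 : 0 ≤ C := by
    obtain ⟨x, hx⟩ := K.nonempty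
    exact (norm_nonneg x).trans (hC x hx)
  have key : ∀ u v, supp K u ≤ supp K v + C * dist u v := fun u v => by
    obtain ⟨x, hx, hxu⟩ := exists_inner_eq_supp K u
    have h1 := inner_le_supp K v hx
    have h2 : inner ℝ x (u - v) ≤ C * ‖u - v‖ :=
      (real_inner_le_norm x (u - v)).trans (mul_le_mul_of_nonneg_right (hC x hx) (norm_nonneg _))
    rw [inner_sub_right] at h2
    rw [dist_eq_norm]
    linarith
  exact (LipschitzWith.of_le_add_mul ⟨C, hC0⟩ key).continuous

theorem supp_scale {c : ℝ} (hc : 0 ≤ c) (K : BodyO n) (u : E n) :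
    supp (K.scale c).1 u = c * supp K.1 u := by
  obtain ⟨y, hy, hyr⟩ := exists_inner_eq_supp K.1 u
  refine supp_eq_of (fun x hx => ?_) ⟨c • y, ⟨y, hy, rfl⟩, ?_⟩
  · obtain ⟨z, hz, rfl⟩ := hx
    change inner ℝ (c • z) u ≤ _
    rw [real_inner_smul_left]
    exact mul_le_mul_of_nonneg_left (inner_le_supp K.1 u hz) hc
  · rw [real_inner_smul_left, hyr]

theorem supp_map (f : E n →ₗ[ℝ] E n) (K : BodyO n) (u : E n) :
    supp (K.map f).1 u = supp K.1 (LinearMap.adjoint f u) :=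
  supp_image f rfl u

end Support

/-! ### The valuation attached to a map of polytopes -/

section Valuation

variable {n : ℕ} {p : ℝ}

open Classical in
/-- The polytope with underlying set `X`; the junk value is `{0}` if `X` is not a polytope
containing the origin. -/
noncomputable def ofSet (X : Set (E n)) : PolytopeO n :=
  if h : IsPolyO X then
    ⟨{ carrier := X
       convex' := by
        obtain ⟨-, S, rfl⟩ := h
        exact convex_convexHull ℝ _
       isCompact' := by
        obtain ⟨-, S, rfl⟩ := h
        exact S.finite_toSet.isCompact_convexHull ℝ
       nonempty' := ⟨0, h.1⟩ }, h.2, h.1⟩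
  else
    ⟨{ carrier := {0}
       convex' := convex_singleton 0
       isCompact' := isCompact_singleton
       nonempty' := Set.singleton_nonempty 0 }, ⟨{0}, by
        rw [Finset.coe_singleton, convexHull_singleton]
        rfl⟩, Set.mem_singleton 0⟩

theorem coe_ofSet {X : Set (E n)} (h : IsPolyO X) : ((ofSet X).1 : Set (E n)) = X := by
  rw [ofSet, dif_pos h]
  rfl

theorem isPolyO_coe (P : PolytopeO n) : IsPolyO (P.1 : Set (E n)) :=
  ⟨P.2.2, P.2.1⟩

theorem ofSet_coe (P : PolytopeO n) : ofSet (P.1 : Set (E n)) = P :=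
  Subtype.ext (ConvexBody.ext (coe_ofSet (isPolyO_coe P)))

theorem inter_nonneg_union_inter_nonpos (X : Set (E n)) (l : Module.Dual ℝ (E n)) :
    X = X ∩ {x | 0 ≤ l x} ∪ X ∩ {x | l x ≤ 0} := by
  rw [← Set.inter_union_distrib_left]
  exact (Set.inter_eq_left.2 fun x _ => le_total 0 (l x)).symm

theorem inter_nonneg_inter_inter_nonpos (X : Set (E n)) (l : Module.Dual ℝ (E n)) :
    X ∩ {x | l x = 0} = X ∩ {x | 0 ≤ l x} ∩ (X ∩ {x | l x ≤ 0}) := by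
  rw [← Set.inter_inter_distrib_left]
  congr 1
  ext x
  exact ⟨fun h => ⟨h.ge, h.le⟩, fun h => le_antisymm h.2 h.1⟩

theorem toEuclideanLin_transpose_inv_adjoint (φ : Matrix.SpecialLinearGroup (Fin n) ℝ) (u : E n) :
    LinearMap.adjoint (Matrix.toEuclideanLin (φ⁻¹.1).transpose) (Matrix.toEuclideanLin φ.1 u)
      = u := by
  rw [← Matrix.conjTranspose_eq_transpose_of_trivial, Matrix.toEuclideanLin_conjTranspose_eq_adjoint,
    LinearMap.adjoint_adjoint, ← LinearMap.comp_apply]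
  have h : φ⁻¹.1 * φ.1 = 1 := by
    rw [← Matrix.SpecialLinearGroup.coe_mul, inv_mul_cancel, Matrix.SpecialLinearGroup.coe_one]
  rw [Matrix.toEuclideanLin_eq_toLin_orthonormal, ← Matrix.toLin_mul, h, Matrix.toLin_one,
    LinearMap.id_apply]

theorem det_toEuclideanLin (A : Matrix (Fin n) (Fin n) ℝ) :
    LinearMap.det (Matrix.toEuclideanLin A) = A.det := by
  rw [Matrix.toEuclideanLin_eq_toLin_orthonormal, LinearMap.det_toLin]

/-- The `p`-th powers of the support functions of an `SL(n)`-contravariant `L_p`-Minkowski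
valuation form a real-valued contravariant valuation. -/
theorem isContraVal_supp (hp : 1 < p) {Φ : PolytopeO n → BodyO n} (hS : IsSLContravariant Φ)
    (hV : IsLpMinkowskiValuation p Φ) :
    IsContraVal p fun X u => supp (Φ (ofSet X)).1 u ^ p where
  nonneg X u := Real.rpow_nonneg (supp_nonneg _ u) _
  continuous X := (continuous_supp _).rpow_const fun _ => Or.inr (by linarith)
  smul X c hc u := by
    rw [supp_smul _ hc.le, Real.mul_rpow hc.le (supp_nonneg _ u)]
  cut X hX l u := by
    rw [← supp_lpSum hp, ← supp_lpSum hp]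
    rw [hV (ofSet (X ∩ {x | 0 ≤ l x})) (ofSet (X ∩ {x | l x ≤ 0}))]
    · rw [coe_ofSet hX, coe_ofSet (hX.inter_nonneg l), coe_ofSet (hX.inter_nonpos l)]
      exact inter_nonneg_union_inter_nonpos X l
    · rw [coe_ofSet (hX.inter_eq_zero l), coe_ofSet (hX.inter_nonneg l),
        coe_ofSet (hX.inter_nonpos l)]
      exact inter_nonneg_inter_inter_nonpos X l
  map f hf X hX u := by
    let A := Matrix.toEuclideanLin.symm f
    have hA : Matrix.toEuclideanLin A = f := LinearEquiv.apply_symm_apply _ f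
    let φ : Matrix.SpecialLinearGroup (Fin n) ℝ := ⟨A, by rw [← det_toEuclideanLin, hA, hf]⟩
    have h1 : ofSet (f '' X) = (ofSet X).map (Matrix.toEuclideanLin φ.1) := by
      refine Subtype.ext (ConvexBody.ext ?_)
      rw [coe_ofSet (hX.image f)]
      change _ = Matrix.toEuclideanLin A '' ((ofSet X).1 : Set (E n))
      rw [coe_ofSet hX, hA]
    have h2 : f u = Matrix.toEuclideanLin φ.1 u := by
      change _ = Matrix.toEuclideanLin A u
      rw [hA]
    change supp (Φ (ofSet (f '' X))).1 (f u) ^ p = _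
    rw [h1, hS, supp_map, h2, toEuclideanLin_transpose_inv_adjoint]

theorem coneSum_cut {X : Set (E n)} (hX : IsPolyO X) {l : Module.Dual ℝ (E n)} (hl : l ≠ 0)
    (g : E n → ℝ) :
    coneSum (ofSet X).1 g = coneSum (ofSet (X ∩ {x | 0 ≤ l x})).1 g
      + coneSum (ofSet (X ∩ {x | l x ≤ 0})).1 g := by
  rw [← coneSum_valuation (U := ofSet X) (I := ofSet (X ∩ {x | l x = 0})), left_eq_add]
  · refine coneSum_eq_zero_of_subset (q := LinearMap.ker l) (by simpa using hl) ?_ g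
    rw [coe_ofSet (hX.inter_eq_zero l)]
    exact fun x hx => hx.2
  · rw [coe_ofSet hX, coe_ofSet (hX.inter_nonneg l), coe_ofSet (hX.inter_nonpos l)]
    exact inter_nonneg_union_inter_nonpos X l
  · rw [coe_ofSet (hX.inter_eq_zero l), coe_ofSet (hX.inter_nonneg l),
      coe_ofSet (hX.inter_nonpos l)]
    exact inter_nonneg_inter_inter_nonpos X l

theorem volume_image_stdSolid (φ : (Fin n → ℝ) ≃ₗ[ℝ] E n) :
    (volume (φ '' stdSolid (Fin n))).toReal
      = |basisDet φ| * (volume (stdSolid (Fin n))).toReal := by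
  let e := WithLp.linearEquiv 2 ℝ (Fin n → ℝ)
  have h : φ '' stdSolid (Fin n)
      = (φ.toLinearMap ∘ₗ e.toLinearMap) '' (WithLp.ofLp ⁻¹' stdSolid (Fin n) : Set (E n)) := by
    ext x
    constructor
    · rintro ⟨y, hy, rfl⟩
      exact ⟨WithLp.toLp 2 y, hy, rfl⟩
    · rintro ⟨y, hy, rfl⟩
      exact ⟨WithLp.ofLp y, hy, rfl⟩
  have hvol : volume (WithLp.ofLp ⁻¹' stdSolid (Fin n) : Set (E n)) = volume (stdSolid (Fin n)) :=
    (EuclideanSpace.volume_preserving_symm_measurableEquiv_toLp (Fin n)).measure_preimage_equiv _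
  rw [h, Measure.addHaar_image_linearMap, ENNReal.toReal_mul, ENNReal.toReal_ofReal (abs_nonneg _),
    hvol]
  rfl

end Valuation

/-! ### The classification -/

section Classification

variable {n : ℕ} {p : ℝ}

theorem exists_inner_eq_sum (φ : (Fin n → ℝ) ≃ₗ[ℝ] E n) :
    ∃ a : E n, ∀ y, inner ℝ (φ y) a = ∑ i, y i := by
  let f : E n →ₗ[ℝ] ℝ := (∑ i, LinearMap.proj i) ∘ₗ φ.symm.toLinearMap
  refine ⟨(InnerProductSpace.toDual ℝ (E n)).symm (LinearMap.toContinuousLinearMap f), fun y => ?_⟩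
  rw [real_inner_comm, InnerProductSpace.toDual_symm_apply]
  simp [f]

theorem supp_rpow_lpSum_scale_proj (hn : 1 ≤ n) (hp : 1 < p) {c₁ c₂ : ℝ} (h₁ : 0 ≤ c₁)
    (h₂ : 0 ≤ c₂) (P : PolytopeO n) (u : E n) :
    supp (lpSum p ((projPlus p P).scale c₁) ((projMinus p P).scale c₂)).1 u ^ p
      = c₁ ^ p * (n * coneSum P.1 fun v => max (inner ℝ v u) 0 ^ p)
        + c₂ ^ p * (n * coneSum P.1 fun v => max (-inner ℝ v u) 0 ^ p) := by
  rw [supp_lpSum hp, supp_scale h₁, supp_scale h₂, Real.mul_rpow h₁ (supp_nonneg _ u),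
    Real.mul_rpow h₂ (supp_nonneg _ u), supp_projPlus hp, supp_projMinus hp,
    facetSum_eq_coneSum hn, facetSum_eq_coneSum hn]
  · intro c hc v
    rw [real_inner_smul_left, ← Real.mul_rpow hc.le (le_max_right _ _), mul_max_of_nonneg _ _ hc.le,
      mul_zero, mul_neg]
  · intro c hc v
    rw [real_inner_smul_left, ← Real.mul_rpow hc.le (le_max_right _ _), mul_max_of_nonneg _ _ hc.le,
      mul_zero]

/-- A contravariant valuation is determined by its values on simplices, where it agrees with a
combination of two sums over facets. -/
theorem IsContraVal.exists_coneSum {z : Set (E n) → E n → ℝ} (hz : IsContraVal p z) (hp : 1 < p)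
    (hn : 3 ≤ n) :
    ∃ α β : ℝ, 0 ≤ α ∧ 0 ≤ β ∧ ∀ X, IsPolyO X → ∀ u,
      z X u = α * coneSum (ofSet X).1 (fun v => max (inner ℝ v u) 0 ^ p)
        + β * coneSum (ofSet X).1 (fun v => max (-inner ℝ v u) 0 ^ p) := by
  obtain ⟨k₁, k₂, hk₁, hk₂, hk⟩ := hz.exists_simplex hp hn
  set T := (volume (stdSolid (Fin n))).toReal with hT
  have hT0 : 0 < T := volume_stdSolid_pos
  refine ⟨k₁ / T, k₂ / T, by positivity, by positivity, fun X hX u => ?_⟩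
  let μ : Set (E n) → ℝ := fun X =>
    z X u - k₁ / T * coneSum (ofSet X).1 (fun v => max (inner ℝ v u) 0 ^ p)
      - k₂ / T * coneSum (ofSet X).1 (fun v => max (-inner ℝ v u) 0 ^ p)
  have hμ : μ X = 0 := by
    refine eq_zero_of_simplex_eq_zero (WithLp.linearEquiv 2 ℝ (Fin n → ℝ)).symm μ
      (fun Y hY l hl => ?_) (fun Y hY l hl hYl => ?_) (fun φ => ?_) hX
    · simp only [μ]
      rw [hz.eq_add hp hn hY hl u, coneSum_cut hY hl, coneSum_cut hY hl]
      ring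
    · have h : ∀ g, coneSum (ofSet Y).1 g = 0 := fun g => by
        refine coneSum_eq_zero_of_subset (q := LinearMap.ker l) (by simpa using hl) ?_ g
        rw [coe_ofSet hY]
        exact hYl
      simp only [μ]
      rw [hz.eq_zero_of_dual hp hn hY hl hYl, h, h]
      ring
    · obtain ⟨a, ha⟩ := exists_inner_eq_sum φ
      obtain ⟨y, rfl⟩ := φ.surjective u
      have hsimplex := coneSum_simplex (by omega) φ (coe_ofSet (isPolyO_image_stdSolid φ)) ha
      simp only [μ]
      rw [hk, hsimplex, hsimplex, real_inner_comm, ha, volume_image_stdSolid, ← hT]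
      field_simp
      ring
  simp only [μ] at hμ
  linarith

theorem isLpMinkowskiValuation_lpSum_proj (hn : 1 ≤ n) (hp : 1 < p) {c₁ c₂ : ℝ} (h₁ : 0 ≤ c₁)
    (h₂ : 0 ≤ c₂) :
    IsLpMinkowskiValuation p fun P : PolytopeO n =>
      lpSum p ((projPlus p P).scale c₁) ((projMinus p P).scale c₂) := by
  intro P Q U I hU hI
  refine eq_of_supp_rpow_eq hp fun u => ?_
  simp only [supp_lpSum hp (lpSum p _ _), supp_rpow_lpSum_scale_proj hn hp h₁ h₂]
  linear_combination c₁ ^ p * n * coneSum_valuation hU hI (fun v => max (inner ℝ v u) 0 ^ p)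
    + c₂ ^ p * n * coneSum_valuation hU hI (fun v => max (-inner ℝ v u) 0 ^ p)

theorem isSLContravariant_lpSum_proj (hn : 1 ≤ n) (hp : 1 < p) {c₁ c₂ : ℝ} (h₁ : 0 ≤ c₁)
    (h₂ : 0 ≤ c₂) :
    IsSLContravariant fun P : PolytopeO n =>
      lpSum p ((projPlus p P).scale c₁) ((projMinus p P).scale c₂) := by
  intro φ P
  refine eq_of_supp_rpow_eq hp fun u => ?_
  have hdet : LinearMap.det (Matrix.toEuclideanLin φ.1) = 1 := by
    rw [det_toEuclideanLin, φ.2]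
  let f : E n ≃ₗ[ℝ] E n := LinearEquiv.ofIsUnitDet (f := Matrix.toEuclideanLin φ.1)
    (v := (EuclideanSpace.basisFun (Fin n) ℝ).toBasis)
    (v' := (EuclideanSpace.basisFun (Fin n) ℝ).toBasis)
    (by rw [LinearMap.det_toMatrix, hdet]; exact isUnit_one)
  have hf : (f : E n →ₗ[ℝ] E n) = Matrix.toEuclideanLin φ.1 := rfl
  set w := LinearMap.adjoint (Matrix.toEuclideanLin (φ⁻¹.1).transpose) u with hw
  have hfu : f.symm u = w := by
    have := toEuclideanLin_transpose_inv_adjoint φ (f.symm u)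
    rw [← hf, LinearEquiv.coe_coe, LinearEquiv.apply_symm_apply] at this
    exact this.symm
  have himg : ((P.map (Matrix.toEuclideanLin φ.1)).1 : Set (E n)) = f '' P.1 := rfl
  rw [supp_map, supp_rpow_lpSum_scale_proj hn hp h₁ h₂, supp_rpow_lpSum_scale_proj hn hp h₁ h₂,
    coneSum_image f himg, coneSum_image f himg, hf, hdet, abs_one, one_mul, one_mul]
  have h : ∀ v, inner ℝ (LinearMap.adjoint (f.symm : E n →ₗ[ℝ] E n) v) u = inner ℝ v w := fun v => by
    rw [LinearMap.adjoint_inner_left, ← hfu]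
    rfl
  simp only [h, hw]

/-- The constants are the roots that turn the coefficients of the cone sums into coefficients of the
facet sums. -/
theorem exists_eq_lpSum_proj (hn : 3 ≤ n) (hp : 1 < p) {Φ : PolytopeO n → BodyO n}
    (hS : IsSLContravariant Φ) (hV : IsLpMinkowskiValuation p Φ) :
    ∃ c₁ c₂ : ℝ, 0 ≤ c₁ ∧ 0 ≤ c₂ ∧ ∀ P : PolytopeO n,
      Φ P = lpSum p ((projPlus p P).scale c₁) ((projMinus p P).scale c₂) := by
  have hn1 : 1 ≤ n := by omega
  obtain ⟨α, β, hα, hβ, h⟩ := (isContraVal_supp hp hS hV).exists_coneSum hp hn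
  have hn0 : (0 : ℝ) < n := by exact_mod_cast hn1
  have hroot : ∀ γ : ℝ, 0 ≤ γ → ((γ / n) ^ (1 / p)) ^ p * n = γ := fun γ hγ => by
    rw [← Real.rpow_mul (by positivity), one_div_mul_cancel (by linarith), Real.rpow_one,
      div_mul_cancel₀ _ hn0.ne']
  refine ⟨(α / n) ^ (1 / p), (β / n) ^ (1 / p), by positivity, by positivity, fun P => ?_⟩
  refine eq_of_supp_rpow_eq hp fun u => ?_
  have hP := h P.1 (isPolyO_coe P) u
  rw [ofSet_coe] at hP
  rw [supp_rpow_lpSum_scale_proj hn1 hp (by positivity) (by positivity), hP, ← mul_assoc,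
    ← mul_assoc, hroot α hα, hroot β hβ]

end Classification

end LpMinkowski

theorem mainTheorem1 (n : ℕ) (hn : 3 ≤ n) (p : ℝ) (hp : 1 < p)
    (Φ : LpMinkowski.PolytopeO n → LpMinkowski.BodyO n) :
    (LpMinkowski.IsSLContravariant Φ ∧ LpMinkowski.IsLpMinkowskiValuation p Φ) ↔
      ∃ c₁ c₂ : ℝ, 0 ≤ c₁ ∧ 0 ≤ c₂ ∧ ∀ P : LpMinkowski.PolytopeO n,
        Φ P = LpMinkowski.lpSum p
          (LpMinkowski.BodyO.scale c₁ (LpMinkowski.projPlus p P))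
          (LpMinkowski.BodyO.scale c₂ (LpMinkowski.projMinus p P)) := by
  constructor
  · rintro ⟨hS, hV⟩
    exact LpMinkowski.exists_eq_lpSum_proj hn hp hS hV
  · rintro ⟨c₁, c₂, h₁, h₂, h⟩
    obtain rfl : Φ = fun P => LpMinkowski.lpSum p
        (LpMinkowski.BodyO.scale c₁ (LpMinkowski.projPlus p P))
        (LpMinkowski.BodyO.scale c₂ (LpMinkowski.projMinus p P)) := funext h
    exact ⟨LpMinkowski.isSLContravariant_lpSum_proj (by omega) hp h₁ h₂,
      LpMinkowski.isLpMinkowskiValuation_lpSum_proj (by omega) hp h₁ h₂⟩
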